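/- Let $\ell$ be an odd prime, $K$ a number field and $L/K$ an $\ell$-extension, i.e. a finite Galois extension of $\ell$-power degree, with group $G=\mathrm{Gal}(L/K)$. For a number field $F$, put $\mathcal R_F=\mathbb Z_\ell\otimes_{\mathbb Z}F^\times$, and for a finite place $v$ of $F$ with completion $F_v$ put $\mathcal R_{F_v}=\varprojlim_n F_v^\times/F_v^{\times\ell^n}$. Let $\mathcal D'_F$ be the free $\mathbb Z_\ell$-module on the primes of $F$ not above $\ell$, let $\mathcal R_F^{bp}\subseteq\mathcal R_F$ be the submodule of the elements whose image in $\mathcal R_{F_v}$ lies in the image of the group of $\ell$-power roots of unity of $F_v$, for every $v\mid\ell$, let $\mathcal P_F^{bp}\subseteq\mathcal D'_F$ be its image under the divisor map, and let $\mathcal C\ell_F^{bp}=\mathcal D'_F/\mathcal P_F^{bp}$. The Bertrandias–Payan module of $F$ is the $\mathbb Z_\ell$-torsion submodule $\mathcal T_F^{bp}$ of $\mathcal C\ell_F^{bp}$. Let $\mathrm{Cap}^{bp}_{L/K}$ be the kernel of the morphism $\mathcal C\ell_K^{bp}\to\mathcal C\ell_L^{bp}$ induced by the extension of ideals. Assume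 that $L/K$ is logarithmically unramified (locally cyclotomic): for every place $v$ of $K$ and every place $w$ of $L$ above $v$, the extension $L_w/K_v$ is contained in the local cyclotomic $\mathbb Z_\ell$-extension $K_v^c=K_v\mathbb Q^c$ of $K_v$, where $\mathbb Q^c$ is the cyclotomic $\mathbb Z_\ell$-extension of $\mathbb Q$. Assume also that $L$ satisfies Leopoldt's conjecture for $\ell$, i.e. that the canonical map $\mathbb Z_\ell\otimes_{\mathbb Z}\mathcal O_L^\times\to\prod_{w\mid\ell}\mathcal R_{L_w}$ is injective. Then, with $\mu_L$ the group of roots of unity of $\ell$-power order in $L$, there is an isomorphism of groups $$\mathrm{Cap}^{bp}_{L/K}\;\simeq\;H^1(G,\mu_L),$$ and likewise the kernel of the induced morphism $\mathcal T_K^{bp}\to\mathcal T_L^{bp}$ is isomorphic to $H^1(G,\mu_L)$. -/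

import Mathlib

open scoped TensorProduct nonZeroDivisors NumberField
open IsDedekindDomain

noncomputable section

namespace BertrandiasPayan

/-! ### `ℓ`-adic completion of abelian groups -/

/-- The canonical ring homomorphism `ℤ_ℓ → lim ℤ/ℓⁿℤ`. -/
def padicToCompletion (ℓ : ℕ) [Fact ℓ.Prime] :
    ℤ_[ℓ] →+* AdicCompletion (Ideal.span {(ℓ : ℤ)}) ℤ :=
  AdicCompletion.liftRingHom (Ideal.span {(ℓ : ℤ)})
    (fun n => (((Ideal.quotEquivOfEq (by
        rw [Ideal.span_singleton_pow, Nat.cast_pow])).toRingHom :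
          ℤ ⧸ Ideal.span {((ℓ ^ n : ℕ) : ℤ)} →+* ℤ ⧸ (Ideal.span {(ℓ : ℤ)}) ^ n).comp
      (Int.quotientSpanNatEquivZMod (ℓ ^ n)).symm.toRingHom).comp
        (PadicInt.toZModPow n))
    (by
      intro m n hmn
      conv_rhs => rw [← PadicInt.zmod_cast_comp_toZModPow m n hmn, ← RingHom.comp_assoc]
      rw [← RingHom.comp_assoc, ← RingHom.comp_assoc]
      exact congrArg (fun g : ZMod (ℓ ^ n) →+* ℤ ⧸ Ideal.span {(ℓ : ℤ)} ^ m =>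
        g.comp (PadicInt.toZModPow (p := ℓ) n)) (Subsingleton.elim _ _))

/-- `lim A / ℓⁿA`, for an abelian group `A` written additively. -/
abbrev EllCompletion (ℓ : ℕ) (A : Type*) [AddCommGroup A] : Type _ :=
  AdicCompletion (Ideal.span {(ℓ : ℤ)}) A

/-- The action of `ℤ_ℓ = lim ℤ/ℓⁿℤ` on `lim A / ℓⁿA`. -/
instance instModuleEllCompletion (ℓ : ℕ) [Fact ℓ.Prime] (A : Type*) [AddCommGroup A] :
    Module ℤ_[ℓ] (EllCompletion ℓ A) :=
  Module.compHom _ (padicToCompletion ℓ)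

/-- `ℛ_K = ℤ_ℓ ⊗ K^×` -/
abbrev GlobalR (ℓ : ℕ) [Fact ℓ.Prime] (K : Type*) [Field K] : Type _ :=
  ℤ_[ℓ] ⊗[ℤ] Additive Kˣ

/-- `ℛ_F = lim F^× / (F^×)^(ℓⁿ)`, for a local field `F`. -/
abbrev LocalR (ℓ : ℕ) (F : Type*) [Field F] : Type _ :=
  EllCompletion ℓ (Additive Fˣ)

/-- The canonical map `F^× → ℛ_F`. -/
def toLocalR (ℓ : ℕ) (F : Type*) [Field F] : Additive Fˣ →ₗ[ℤ] LocalR ℓ F :=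
  AdicCompletion.of (Ideal.span {(ℓ : ℤ)}) (Additive Fˣ)

/-- The homomorphism of additively written unit groups induced by a ring homomorphism. -/
def unitsMap {A B : Type*} [CommRing A] [CommRing B] (f : A →+* B) :
    Additive Aˣ →ₗ[ℤ] Additive Bˣ :=
  (MonoidHom.toAdditive (Units.map f.toMonoidHom)).toIntLinearMap

/-- The `ℤ_ℓ`-linear map `ℛ_K → ℛ_F` induced by a field embedding `K → F`. -/
def localize (ℓ : ℕ) [Fact ℓ.Prime] {K F : Type*} [Field K] [Field F] (f : K →+* F) :
    GlobalR ℓ K →ₗ[ℤ_[ℓ]] LocalR ℓ F :=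
  LinearMap.liftBaseChange ℤ_[ℓ] ((toLocalR ℓ F).comp (unitsMap f))

/-- The `ℓ`-group `μ_F` of roots of unity of `ℓ`-power order of a local field `F`, as a
`ℤ_ℓ`-submodule of `ℛ_F`. -/
def localMu (ℓ : ℕ) [Fact ℓ.Prime] (F : Type*) [Field F] : Submodule ℤ_[ℓ] (LocalR ℓ F) :=
  Submodule.span ℤ_[ℓ] {x | ∃ ζ : Fˣ, (∃ n : ℕ, ζ ^ ℓ ^ n = 1) ∧ x = toLocalR ℓ F (Additive.ofMul ζ)}

/-! ### Places and divisors -/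

/-- The finite places of `K` above `ℓ`. -/
abbrev WildPlace (ℓ : ℕ) (K : Type*) [Field K] : Type _ :=
  {v : HeightOneSpectrum (𝓞 K) // (ℓ : 𝓞 K) ∈ v.asIdeal}

/-- The finite places of `K` not above `ℓ`. -/
abbrev TamePlace (ℓ : ℕ) (K : Type*) [Field K] : Type _ :=
  {v : HeightOneSpectrum (𝓞 K) // (ℓ : 𝓞 K) ∉ v.asIdeal}

/-- `𝒟'_K`: the free `ℤ_ℓ`-module on the finite places of `K` not above `ℓ`. -/
abbrev Divisor (ℓ : ℕ) [Fact ℓ.Prime] (K : Type*) [Field K] : Type _ :=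
  TamePlace ℓ K →₀ ℤ_[ℓ]

/-- The divisor prime to `ℓ` of a fractional ideal `I`: its coefficient at `v` is the `v`-adic
valuation of `I`. -/
def idealDivisor (ℓ : ℕ) [Fact ℓ.Prime] (K : Type*) [Field K] [NumberField K]
    (I : FractionalIdeal (𝓞 K)⁰ K) : Divisor ℓ K :=
  Finsupp.ofSupportFinite (fun v => ((FractionalIdeal.count K v.1 I : ℤ) : ℤ_[ℓ])) (by
    have h := (Filter.eventually_cofinite.mp (FractionalIdeal.finite_factors I))
    refine (h.preimage Subtype.val_injective.injOn).subset ?_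
    intro v hv h0
    exact hv (by simp [h0]))

theorem idealDivisor_apply (ℓ : ℕ) [Fact ℓ.Prime] (K : Type*) [Field K] [NumberField K]
    (I : FractionalIdeal (𝓞 K)⁰ K) (v : TamePlace ℓ K) :
    idealDivisor ℓ K I v = ((FractionalIdeal.count K v.1 I : ℤ) : ℤ_[ℓ]) := rfl

theorem idealDivisor_mul (ℓ : ℕ) [Fact ℓ.Prime] (K : Type*) [Field K] [NumberField K]
    {I J : FractionalIdeal (𝓞 K)⁰ K} (hI : I ≠ 0) (hJ : J ≠ 0) :
    idealDivisor ℓ K (I * J) = idealDivisor ℓ K I + idealDivisor ℓ K J := by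
  ext v
  simp [idealDivisor_apply, FractionalIdeal.count_mul K v.1 hI hJ]

theorem idealDivisor_one (ℓ : ℕ) [Fact ℓ.Prime] (K : Type*) [Field K] [NumberField K] :
    idealDivisor ℓ K 1 = 0 := by
  ext v
  simp [idealDivisor_apply, FractionalIdeal.count_one]

/-- The divisor prime to `ℓ` of an element of `K^×`. -/
def principalDivisor (ℓ : ℕ) [Fact ℓ.Prime] (K : Type*) [Field K] [NumberField K] :
    Additive Kˣ →+ Divisor ℓ K where
  toFun x := idealDivisor ℓ K (FractionalIdeal.spanSingleton (𝓞 K)⁰ (x.toMul : K))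
  map_zero' := by simp [idealDivisor_one]
  map_add' x y := by
    rw [← idealDivisor_mul ℓ K (FractionalIdeal.spanSingleton_ne_zero_iff.mpr x.toMul.ne_zero)
      (FractionalIdeal.spanSingleton_ne_zero_iff.mpr y.toMul.ne_zero),
      FractionalIdeal.spanSingleton_mul_spanSingleton]
    simp

/-- The `ℤ_ℓ`-linear divisor map `ℛ_K → 𝒟'_K`. -/
def divisorMap (ℓ : ℕ) [Fact ℓ.Prime] (K : Type*) [Field K] [NumberField K] :
    GlobalR ℓ K →ₗ[ℤ_[ℓ]] Divisor ℓ K :=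
  LinearMap.liftBaseChange ℤ_[ℓ] (principalDivisor ℓ K).toIntLinearMap

/-- Extension of divisors `𝒟'_K → 𝒟'_L`: a prime `𝔭` is sent to the divisor of `𝔭 𝓞_L`. -/
def divisorExtension (ℓ : ℕ) [Fact ℓ.Prime] (K L : Type*) [Field K] [NumberField K]
    [Field L] [NumberField L] [Algebra K L] : Divisor ℓ K →ₗ[ℤ_[ℓ]] Divisor ℓ L :=
  Finsupp.linearCombination ℤ_[ℓ] fun v =>
    idealDivisor ℓ L ((v.1.asIdeal.map (algebraMap (𝓞 K) (𝓞 L)) : Ideal (𝓞 L)) :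
      FractionalIdeal (𝓞 L)⁰ L)

/-! ### Pseudo-infinitesimal classes -/

/-- `ℛ_K^bp`: the pseudo-infinitesimal elements of `ℛ_K`, i.e. those which are locally roots of
unity at all places above `ℓ`. -/
def pseudoInfinitesimal (ℓ : ℕ) [Fact ℓ.Prime] (K : Type*) [Field K] [NumberField K] :
    Submodule ℤ_[ℓ] (GlobalR ℓ K) :=
  ⨅ v : WildPlace ℓ K, (localMu ℓ (v.1.adicCompletion K)).comap
    (localize ℓ (algebraMap K (v.1.adicCompletion K)))

/-- `𝒫_K^bp`: the principal divisors generated by the pseudo-infinitesimal elements. -/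
def principalBP (ℓ : ℕ) [Fact ℓ.Prime] (K : Type*) [Field K] [NumberField K] :
    Submodule ℤ_[ℓ] (Divisor ℓ K) :=
  (pseudoInfinitesimal ℓ K).map (divisorMap ℓ K)

/-- `𝒞ℓ_K^bp = 𝒟'_K / 𝒫_K^bp`: the group of pseudo-infinitesimal classes. -/
abbrev ClassBP (ℓ : ℕ) [Fact ℓ.Prime] (K : Type*) [Field K] [NumberField K] : Type _ :=
  Divisor ℓ K ⧸ principalBP ℓ K

/-- `𝒯_K^bp`: the Bertrandias–Payan module, i.e. the `ℤ_ℓ`-torsion submodule of `𝒞ℓ_K^bp`. -/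
abbrev torsionBP (ℓ : ℕ) [Fact ℓ.Prime] (K : Type*) [Field K] [NumberField K] :
    Submodule ℤ_[ℓ] (ClassBP ℓ K) :=
  Submodule.torsion ℤ_[ℓ] (ClassBP ℓ K)

/-! ### Completions in an extension -/

/-- The embedding `K_v → L_w` of completions, for a place `w` of `L` above a place `v` of `K`. -/
def completionMap {K L : Type*} [Field K] [NumberField K] [Field L] [NumberField L] [Algebra K L]
    (v : HeightOneSpectrum (𝓞 K)) (w : HeightOneSpectrum (𝓞 L))
    [w.asIdeal.LiesOver v.asIdeal] : v.adicCompletion K →+* w.adicCompletion L :=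
  ((HeightOneSpectrum.adicCompletion.equiv L w).symm.toRingHom.comp
    (UniformSpace.Completion.mapRingHom
      (algebraMap (WithVal (v.valuation K)) (WithVal (w.valuation L)))
      (HeightOneSpectrum.uniformContinuous_algebraMap_liesOver K L v w).continuous)).comp
    (HeightOneSpectrum.adicCompletion.equiv K v).toRingHom

theorem completionMap_algebraMap {K L : Type*} [Field K] [NumberField K] [Field L] [NumberField L]
    [Algebra K L] (v : HeightOneSpectrum (𝓞 K)) (w : HeightOneSpectrum (𝓞 L))
    [w.asIdeal.LiesOver v.asIdeal] :
    (completionMap v w).comp (algebraMap K (v.adicCompletion K)) =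
      (algebraMap L (w.adicCompletion L)).comp (algebraMap K L) := by
  refine RingHom.ext fun x => ?_
  apply HeightOneSpectrum.adicCompletion.ext
  exact UniformSpace.Completion.mapRingHom_coe _ _

/-! ### Functoriality of the pseudo-infinitesimal elements -/

/-- The map `ℛ_K → ℛ_L` induced by `K → L`. -/
def globalExtension (ℓ : ℕ) [Fact ℓ.Prime] (K L : Type*) [Field K] [Field L] [Algebra K L] :
    GlobalR ℓ K →ₗ[ℤ_[ℓ]] GlobalR ℓ L :=
  (unitsMap (algebraMap K L)).baseChange ℤ_[ℓ]

/-- The map `ℛ_F → ℛ_F'` induced by an embedding `F → F'` of local fields. -/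
def localExtension (ℓ : ℕ) [Fact ℓ.Prime] {F F' : Type*} [Field F] [Field F'] (f : F →+* F') :
    LocalR ℓ F →ₗ[ℤ_[ℓ]] LocalR ℓ F' where
  toFun := AdicCompletion.map (Ideal.span {(ℓ : ℤ)}) (unitsMap f)
  map_add' := map_add _
  map_smul' z x := map_smul (AdicCompletion.map (Ideal.span {(ℓ : ℤ)}) (unitsMap f))
    (padicToCompletion ℓ z) x

theorem localExtension_toLocalR (ℓ : ℕ) [Fact ℓ.Prime] {F F' : Type*} [Field F] [Field F']
    (f : F →+* F') (x : Additive Fˣ) :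
    localExtension ℓ f (toLocalR ℓ F x) = toLocalR ℓ F' (unitsMap f x) :=
  AdicCompletion.map_of _ _ _

theorem localExtension_localize (ℓ : ℕ) [Fact ℓ.Prime] {K F F' : Type*} [Field K] [Field F]
    [Field F'] (f : K →+* F) (g : F →+* F') :
    (localExtension ℓ g).comp (localize ℓ f) = localize ℓ (g.comp f) := by
  ext x
  simp [localize, localExtension_toLocalR]
  rfl

theorem localize_globalExtension (ℓ : ℕ) [Fact ℓ.Prime] {K L F : Type*} [Field K] [Field L]
    [Field F] [Algebra K L] (f : L →+* F) :
    (localize ℓ f).comp (globalExtension ℓ K L) = localize ℓ (f.comp (algebraMap K L)) := by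
  ext x
  simp [localize, globalExtension]
  rfl

theorem localExtension_mem_localMu (ℓ : ℕ) [Fact ℓ.Prime] {F F' : Type*} [Field F] [Field F']
    (f : F →+* F') {x : LocalR ℓ F} (hx : x ∈ localMu ℓ F) :
    localExtension ℓ f x ∈ localMu ℓ F' := by
  suffices h : localMu ℓ F ≤ (localMu ℓ F').comap (localExtension ℓ f) from h hx
  refine Submodule.span_le.mpr ?_
  rintro _ ⟨ζ, ⟨n, hn⟩, rfl⟩
  refine Submodule.subset_span ⟨Units.map f.toMonoidHom ζ, ⟨n, ?_⟩, localExtension_toLocalR ℓ f _⟩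
  rw [← map_pow, hn, map_one]

theorem globalExtension_mem (ℓ : ℕ) [Fact ℓ.Prime] (K L : Type*) [Field K] [NumberField K]
    [Field L] [NumberField L] [Algebra K L] {x : GlobalR ℓ K} (hx : x ∈ pseudoInfinitesimal ℓ K) :
    globalExtension ℓ K L x ∈ pseudoInfinitesimal ℓ L := by
  simp only [pseudoInfinitesimal, Submodule.mem_iInf, Submodule.mem_comap] at hx ⊢
  intro w
  let v : HeightOneSpectrum (𝓞 K) := ⟨w.1.asIdeal.under (𝓞 K), inferInstance,
    Ideal.IsIntegral.comap_ne_bot (𝓞 K) w.1.ne_bot⟩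
  have : w.1.asIdeal.LiesOver v.asIdeal := ⟨rfl⟩
  have hv : (ℓ : 𝓞 K) ∈ v.asIdeal := by
    change algebraMap (𝓞 K) (𝓞 L) (ℓ : 𝓞 K) ∈ w.1.asIdeal
    rw [map_natCast]
    exact w.2
  have h := localExtension_mem_localMu ℓ (completionMap v w.1) (hx ⟨v, hv⟩)
  rw [← LinearMap.comp_apply, localExtension_localize, completionMap_algebraMap,
    ← localize_globalExtension] at h
  exact h

open Classical in
theorem divisorExtension_idealDivisor (ℓ : ℕ) [Fact ℓ.Prime] (K L : Type*) [Field K]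
    [NumberField K] [Field L] [NumberField L] [Algebra K L] (I : Ideal (𝓞 K)) (hI : I ≠ ⊥) :
    divisorExtension ℓ K L (idealDivisor ℓ K (I : FractionalIdeal (𝓞 K)⁰ K)) =
      idealDivisor ℓ L ((I.map (algebraMap (𝓞 K) (𝓞 L)) : Ideal (𝓞 L)) :
        FractionalIdeal (𝓞 L)⁰ L) := by
  have hmap : ∀ J : Ideal (𝓞 K), J ≠ ⊥ → J.map (algebraMap (𝓞 K) (𝓞 L)) ≠ ⊥ := fun J hJ h =>
    hJ ((Ideal.map_eq_bot_iff_of_injective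
      (FaithfulSMul.algebraMap_injective (𝓞 K) (𝓞 L))).mp h)
  induction I using UniqueFactorizationMonoid.induction_on_prime with
  | h₁ => exact absurd rfl hI
  | h₂ J hJ =>
    rw [Ideal.isUnit_iff] at hJ
    subst hJ
    simp [Ideal.map_top, idealDivisor_one]
  | h₃ J P hJ hP ih =>
    have hP0 : P ≠ ⊥ := hP.ne_zero
    have key : divisorExtension ℓ K L (idealDivisor ℓ K (P : FractionalIdeal (𝓞 K)⁰ K)) =
        idealDivisor ℓ L ((P.map (algebraMap (𝓞 K) (𝓞 L)) : Ideal (𝓞 L)) :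
          FractionalIdeal (𝓞 L)⁰ L) := by
      let v : HeightOneSpectrum (𝓞 K) := ⟨P, Ideal.isPrime_of_prime hP, hP0⟩
      by_cases hv : (ℓ : 𝓞 K) ∈ P
      · have h1 : idealDivisor ℓ K (P : FractionalIdeal (𝓞 K)⁰ K) = 0 := by
          ext u
          have hu : v ≠ u.1 := fun h => u.2 (h ▸ hv)
          have := FractionalIdeal.count_maximal_coprime K u.1 hu
          rw [idealDivisor_apply]
          simp [show FractionalIdeal.count K u.1 (P : FractionalIdeal (𝓞 K)⁰ K) = 0 from this]
        have h2 : idealDivisor ℓ L ((P.map (algebraMap (𝓞 K) (𝓞 L)) : Ideal (𝓞 L)) :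
            FractionalIdeal (𝓞 L)⁰ L) = 0 := by
          ext w
          rw [idealDivisor_apply, FractionalIdeal.count_coe L w.1 (hmap P hP0)]
          have : (Associates.mk w.1.asIdeal).count
              (Associates.mk (P.map (algebraMap (𝓞 K) (𝓞 L)))).factors = 0 := by
            by_contra h
            rw [← ne_eq, Associates.count_ne_zero_iff_dvd (hmap P hP0) w.1.irreducible] at h
            apply w.2
            have := Ideal.le_of_dvd h (Ideal.mem_map_of_mem _ hv)
            rwa [map_natCast] at this
          simp [this]
        rw [h1, h2, map_zero]
      · have h1 : idealDivisor ℓ K (P : FractionalIdeal (𝓞 K)⁰ K) =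
            Finsupp.single ⟨v, hv⟩ 1 := by
          ext u
          rw [idealDivisor_apply, Finsupp.single_apply]
          split_ifs with h
          · subst h
            simp [show FractionalIdeal.count K v (P : FractionalIdeal (𝓞 K)⁰ K) = 1 from
              FractionalIdeal.count_self K v]
          · have hu : v ≠ u.1 := fun h' => h (Subtype.ext h')
            simp [show FractionalIdeal.count K u.1 (P : FractionalIdeal (𝓞 K)⁰ K) = 0 from
              FractionalIdeal.count_maximal_coprime K u.1 hu]
        rw [h1, divisorExtension, Finsupp.linearCombination_single, one_smul]
    have hJ' : J ≠ ⊥ := hJ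
    rw [Ideal.map_mul, FractionalIdeal.coeIdeal_mul, FractionalIdeal.coeIdeal_mul,
      idealDivisor_mul _ _ (by simpa using hP0) (by simpa using hJ'),
      idealDivisor_mul _ _ (by simpa using hmap P hP0) (by simpa using hmap J hJ'),
      map_add, key, ih hJ']

theorem divisorExtension_divisorMap (ℓ : ℕ) [Fact ℓ.Prime] (K L : Type*) [Field K]
    [NumberField K] [Field L] [NumberField L] [Algebra K L] :
    (divisorExtension ℓ K L).comp (divisorMap ℓ K) =
      (divisorMap ℓ L).comp (globalExtension ℓ K L) := by
  have hint : ∀ a : 𝓞 K, ∀ (ha : algebraMap (𝓞 K) K a ≠ 0),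
      divisorExtension ℓ K L (principalDivisor ℓ K (Additive.ofMul (Units.mk0 _ ha))) =
        principalDivisor ℓ L (unitsMap (algebraMap K L) (Additive.ofMul (Units.mk0 _ ha))) := by
    intro a ha
    have ha' : a ≠ 0 := fun h => ha (by simp [h])
    have := divisorExtension_idealDivisor ℓ K L (Ideal.span {a}) (by simpa using ha')
    rw [Ideal.map_span, Set.image_singleton, FractionalIdeal.coeIdeal_span_singleton,
      FractionalIdeal.coeIdeal_span_singleton] at this
    exact this
  ext x
  suffices h : divisorExtension ℓ K L (principalDivisor ℓ K x) =
      principalDivisor ℓ L (unitsMap (algebraMap K L) x) by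
    simpa [divisorMap, globalExtension] using DFunLike.congr_fun h _
  obtain ⟨a, b, hb, hab⟩ := IsFractionRing.div_surjective (A := 𝓞 K) (x.toMul : K)
  have hb0 : algebraMap (𝓞 K) K b ≠ 0 := by
    simpa using nonZeroDivisors.ne_zero hb
  have ha0 : algebraMap (𝓞 K) K a ≠ 0 := by
    intro h
    rw [h, zero_div] at hab
    exact x.toMul.ne_zero hab.symm
  have hx : x = Additive.ofMul (Units.mk0 _ ha0) - Additive.ofMul (Units.mk0 _ hb0) := by
    apply Additive.toMul.injective
    ext
    simp [← hab]
  rw [hx, map_sub, map_sub, map_sub, map_sub, hint, hint]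

theorem principalBP_le_comap (ℓ : ℕ) [Fact ℓ.Prime] (K L : Type*) [Field K] [NumberField K]
    [Field L] [NumberField L] [Algebra K L] :
    principalBP ℓ K ≤ (principalBP ℓ L).comap (divisorExtension ℓ K L) := by
  rintro _ ⟨x, hx, rfl⟩
  exact ⟨globalExtension ℓ K L x, globalExtension_mem ℓ K L hx,
    (DFunLike.congr_fun (divisorExtension_divisorMap ℓ K L) x).symm⟩

/-! ### Capitulation -/

/-- The extension morphism `𝒞ℓ_K^bp → 𝒞ℓ_L^bp`. -/
def classExtension (ℓ : ℕ) [Fact ℓ.Prime] (K L : Type*) [Field K] [NumberField K]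
    [Field L] [NumberField L] [Algebra K L] : ClassBP ℓ K →ₗ[ℤ_[ℓ]] ClassBP ℓ L :=
  Submodule.mapQ _ _ (divisorExtension ℓ K L) (principalBP_le_comap ℓ K L)

/-- The extension morphism `𝒯_K^bp → 𝒯_L^bp` between Bertrandias–Payan modules. -/
def torsionExtension (ℓ : ℕ) [Fact ℓ.Prime] (K L : Type*) [Field K] [NumberField K]
    [Field L] [NumberField L] [Algebra K L] : torsionBP ℓ K →ₗ[ℤ_[ℓ]] torsionBP ℓ L :=
  (classExtension ℓ K L).restrict (by
    rintro x ⟨a, ha⟩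
    exact ⟨a, ((classExtension ℓ K L).map_smul (a : ℤ_[ℓ]) x).symm.trans
      ((congrArg _ ha).trans (map_zero _))⟩)

/-! ### Leopoldt's conjecture -/

/-- Leopoldt's conjecture for the number field `K` and the prime `ℓ`: the canonical map
`ℤ_ℓ ⊗ E_K → ∏_{v ∣ ℓ} ℛ_{K_v}` is injective, where `E_K` is the group of units of `K`. -/
def LeopoldtConjecture (ℓ : ℕ) [Fact ℓ.Prime] (K : Type*) [Field K] [NumberField K] : Prop :=
  Function.Injective (LinearMap.pi fun v : WildPlace ℓ K =>
    (localize ℓ (algebraMap K (v.1.adicCompletion K))).comp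
      ((unitsMap (algebraMap (𝓞 K) K)).baseChange ℤ_[ℓ]))

/-! ### Locally cyclotomic extensions -/

/-- `ℚ(μ_{ℓ^∞})` -/
def rationalCyclotomicTower (ℓ : ℕ) : IntermediateField ℚ (AlgebraicClosure ℚ) :=
  IntermediateField.adjoin ℚ {ζ | ∃ n : ℕ, ζ ^ ℓ ^ n = 1}

/-- The cyclotomic `ℤ_ℓ`-extension `ℚ^c` of `ℚ`, for an odd prime `ℓ`: the compositum of all
subfields of `ℚ(μ_{ℓ^∞})` of `ℓ`-power degree over `ℚ`. -/
def rationalCyclotomicZl (ℓ : ℕ) : IntermediateField ℚ (AlgebraicClosure ℚ) :=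
  ⨆ E : {E : IntermediateField ℚ (AlgebraicClosure ℚ) //
    E ≤ rationalCyclotomicTower ℓ ∧ ∃ n : ℕ, Module.finrank ℚ E = ℓ ^ n}, E.1

/-- The cyclotomic `ℤ_ℓ`-extension `F^c = F ℚ^c` of a field `F` of characteristic `0`, inside an
algebraic closure of `F`. -/
def cyclotomicZl (ℓ : ℕ) (F : Type*) [Field F] : IntermediateField F (AlgebraicClosure F) :=
  IntermediateField.adjoin F
    {x | ∃ φ : rationalCyclotomicZl ℓ →+* AlgebraicClosure F, x ∈ φ.range}

/-- `L/K` is locally cyclotomic (logarithmically unramified): for all finite places `v` of `K` and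
`w` of `L` above `v`, the local extension `L_w/K_v` is contained in the local cyclotomic
`ℤ_ℓ`-extension `K_v^c/K_v`. -/
def IsLocallyCyclotomic (ℓ : ℕ) (K L : Type*) [Field K] [NumberField K]
    [Field L] [NumberField L] [Algebra K L] : Prop :=
  ∀ (v : HeightOneSpectrum (𝓞 K)) (w : HeightOneSpectrum (𝓞 L)) [w.asIdeal.LiesOver v.asIdeal],
    ∃ σ : w.adicCompletion L →+* AlgebraicClosure (v.adicCompletion K),
      σ.comp (completionMap v w) =
        algebraMap (v.adicCompletion K) (AlgebraicClosure (v.adicCompletion K)) ∧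
      ∀ x, σ x ∈ cyclotomicZl ℓ (v.adicCompletion K)

/-! ### Roots of unity and their cohomology -/

/-- `μ_L`: the group of roots of unity of `ℓ`-power order of `L`. -/
abbrev globalMu (ℓ : ℕ) [Fact ℓ.Prime] (L : Type*) [Field L] : Subgroup Lˣ :=
  CommGroup.primaryComponent Lˣ ℓ

/-- The action of `Gal(L/K)` on `μ_L`. -/
instance instGaloisActionMu (ℓ : ℕ) [Fact ℓ.Prime] (K L : Type*) [Field K] [Field L]
    [Algebra K L] : MulDistribMulAction (L ≃ₐ[K] L) (globalMu ℓ L) where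
  smul σ ζ := ⟨σ • (ζ : Lˣ), by
    obtain ⟨n, hn⟩ := CommMonoid.mem_primaryComponent.mp ζ.2
    exact CommMonoid.mem_primaryComponent.mpr ⟨n, by rw [← smul_pow', hn, smul_one]⟩⟩
  one_smul ζ := Subtype.ext (one_smul _ (ζ : Lˣ))
  mul_smul σ τ ζ := Subtype.ext (mul_smul σ τ (ζ : Lˣ))
  smul_mul σ ζ ξ := Subtype.ext (smul_mul' σ (ζ : Lˣ) (ξ : Lˣ))
  smul_one σ := Subtype.ext (smul_one σ)

/-- `H¹(Gal(L/K), μ_L)` -/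
abbrev H1Mu (ℓ : ℕ) [Fact ℓ.Prime] (K L : Type) [Field K] [Field L] [Algebra K L] : Type :=
  groupCohomology.H1 (Rep.ofMulDistribMulAction (L ≃ₐ[K] L) (globalMu ℓ L))

end BertrandiasPayan

end

/-!
Write `G = Gal(L/K)`. Everything is compared with the group `N` (`descentPairs`) of the pairs
`(x, d)` where `x` is a pseudo-infinitesimal element of `ℛ_L` and `d` is a divisor of `K` whose
extension to `L` is the divisor of `x`. It has two quotients: `(x, d) ↦ [d]` maps `N` onto the
capitulation kernel, by definition of the latter, and `(x, d) ↦ [σ ↦ σ x - x]` maps `N` to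
`H¹(G, μ_L)`. The second map makes sense because `σ x - x` is pseudo-infinitesimal with trivial
divisor. Such an element lies in `ℤ_ℓ ⊗ E_L`, as its orders at the places above `ℓ` vanish too, and
it is torsion in all the `ℛ_{L_w}` with `w ∣ ℓ`; so Leopoldt's conjecture makes it a root of unity
(`exists_root_of_divisorMap_eq_zero`). Both maps have the same kernel, the pairs for which `x` is
the sum of a root of unity and of a pseudo-infinitesimal element of `ℛ_K`; hence the isomorphism,
once the second map is known to be surjective. Finally the capitulation kernel is killed by a
power of `ℓ` element by element, because `σ x - x` is torsion and `ℛ_L^G = ℛ_K`; so it equals the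
kernel on the torsion submodules.

The hypothesis that `L/K` is locally cyclotomic enters through two local facts.

* An element of `L_w^×` with an `ℓⁿ`-th power in `K_v` is the product of an `ℓ`-power root of unity
  and an element of `K_v` (`exists_root_mul_completionMap`). This is Kummer theory inside
  `F(μ_{ℓ^∞})`, whose finite layers are cyclic over `F` for odd `ℓ`
  (`exists_eq_root_mul_of_pow_mem`). It implies that an element of `ℛ_K` that becomes
  pseudo-infinitesimal in `ℛ_L` is so already in `ℛ_K`, which is used for the equality of kernels.
  It also gives the surjectivity onto `H¹(G, μ_L)`
  (`exists_pseudoInfinitesimal_of_cocycle`): by Hilbert 90 a cocycle is `σ ↦ σ y / y` with `y ∈ L^×`,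
  and `y` has an `ℓⁿ`-th power in `K`, so it agrees up to roots of unity with an element of `K_v^×`
  at each `v ∣ ℓ`. Since `ℛ_K` maps onto the families of such elements (`exists_localize_eq`), `y`
  can be corrected by an element of `ℛ_K` into a pseudo-infinitesimal one.
* `L/K` is unramified outside `ℓ` (`ramificationIdx_eq_one`), because adjoining roots of unity of
  order prime to the residue characteristic leaves a uniformizer square-free
  (`dvd_of_mem_radical_of_mem_adjoin`). Hence the extension of divisors preserves coefficients, is
  injective, and has a torsion-free cokernel (`exists_divisorExtension_eq`).
-/

noncomputable section

namespace BertrandiasPayan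

/-! ### Tensoring abelian groups with the `ℓ`-adic integers -/

section Tensor

variable {ℓ : ℕ} [Fact ℓ.Prime]

theorem baseChange_injective {A B : Type*} [AddCommGroup A] [AddCommGroup B] {f : A →ₗ[ℤ] B}
    (hf : Function.Injective f) : Function.Injective (f.baseChange ℤ_[ℓ]) :=
  Module.Flat.lTensor_preserves_injective_linearMap (M := ℤ_[ℓ]) f hf

/-- Flatness, in the form: base change to `ℤ_ℓ` preserves kernels. -/
theorem mem_range_baseChange {A B C : Type*} [AddCommGroup A] [AddCommGroup B] [AddCommGroup C]
    {f : A →ₗ[ℤ] B} {g : B →ₗ[ℤ] C} (hfg : Function.Exact f g) {x : ℤ_[ℓ] ⊗[ℤ] B}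
    (hx : g.baseChange ℤ_[ℓ] x = 0) : ∃ y, f.baseChange ℤ_[ℓ] y = x :=
  (Module.Flat.lTensor_exact ℤ_[ℓ] hfg x).mp hx

theorem exists_int_add_pow_mul (z : ℤ_[ℓ]) (n : ℕ) :
    ∃ (m : ℤ) (y : ℤ_[ℓ]), z = m + (ℓ : ℤ_[ℓ]) ^ n * y := by
  obtain ⟨y, hy⟩ := Ideal.mem_span_singleton.mp (PadicInt.appr_spec n z)
  exact ⟨z.appr n, y, by rw [← hy]; push_cast; ring⟩

/-- On an element of `ℓ`-power order, `ℤ_ℓ` acts through `ℤ`. -/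
theorem smul_eq_intCast_smul {M : Type*} [AddCommGroup M] [Module ℤ_[ℓ] M] {x : M} {n : ℕ}
    (hx : ℓ ^ n • x = 0) (z : ℤ_[ℓ]) : ∃ m : ℤ, z • x = m • x := by
  obtain ⟨m, y, rfl⟩ := exists_int_add_pow_mul z n
  refine ⟨m, ?_⟩
  rw [add_smul, mul_comm, mul_smul, ← Nat.cast_pow, Nat.cast_smul_eq_nsmul, hx, smul_zero,
    add_zero, Int.cast_smul_eq_zsmul]

/-- Multiplication by `ℓⁿ` on `ℤ_ℓ ⊗ A` is the base change of multiplication by `ℓⁿ` on `A`. -/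
theorem baseChange_pow_smul {A : Type*} [AddCommGroup A] (n : ℕ) (x : ℤ_[ℓ] ⊗[ℤ] A) :
    ((ℓ ^ n • LinearMap.id : A →ₗ[ℤ] A)).baseChange ℤ_[ℓ] x = ℓ ^ n • x := by
  induction x using TensorProduct.induction_on with
  | zero => simp
  | tmul z a =>
    rw [LinearMap.baseChange_tmul, LinearMap.smul_apply, LinearMap.id_apply,
      TensorProduct.tmul_smul]
  | add y₁ y₂ h₁ h₂ => rw [map_add, h₁, h₂, smul_add]

/-- A tensor over a module killed by `ℓⁿ` is pure, with first factor `1`. -/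
theorem eq_one_tmul {T : Type*} [AddCommGroup T] {n : ℕ} (hT : ∀ t : T, ℓ ^ n • t = 0)
    (y : ℤ_[ℓ] ⊗[ℤ] T) : ∃ t : T, y = 1 ⊗ₜ t := by
  induction y using TensorProduct.induction_on with
  | zero => exact ⟨0, by simp⟩
  | tmul z a =>
    obtain ⟨m, hm⟩ := smul_eq_intCast_smul (ℓ := ℓ) (x := (1 : ℤ_[ℓ]) ⊗ₜ[ℤ] a) (n := n)
      (by rw [← TensorProduct.tmul_smul, hT, TensorProduct.tmul_zero]) z
    refine ⟨m • a, ?_⟩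
    rw [TensorProduct.tmul_smul, ← hm, TensorProduct.smul_tmul', smul_eq_mul, mul_one]
  | add y₁ y₂ h₁ h₂ =>
    obtain ⟨t₁, rfl⟩ := h₁
    obtain ⟨t₂, rfl⟩ := h₂
    exact ⟨t₁ + t₂, (TensorProduct.tmul_add _ _ _).symm⟩

/-- The `ℓ`-power torsion of `ℤ_ℓ ⊗ A` comes from that of `A`. -/
theorem exists_one_tmul_eq {A : Type*} [AddCommGroup A] {n : ℕ} {x : ℤ_[ℓ] ⊗[ℤ] A}
    (hx : ℓ ^ n • x = 0) : ∃ a : A, ℓ ^ n • a = 0 ∧ x = 1 ⊗ₜ a := by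
  let g : A →ₗ[ℤ] A := (ℓ ^ n : ℕ) • LinearMap.id
  obtain ⟨y, rfl⟩ := mem_range_baseChange (ℓ := ℓ) (f := (LinearMap.ker g).subtype) (g := g)
    (fun a => by simp) ((baseChange_pow_smul n x).trans hx)
  obtain ⟨t, rfl⟩ := eq_one_tmul (n := n) (fun t : LinearMap.ker g => Subtype.ext t.2) y
  exact ⟨t, t.2, rfl⟩

/-- `A → ℤ_ℓ ⊗ A` is injective on `ℓ`-power torsion. -/
theorem eq_zero_of_one_tmul_eq_zero {A : Type*} [AddCommGroup A] {n : ℕ} {a : A}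
    (ha : ℓ ^ n • a = 0) (h : (1 : ℤ_[ℓ]) ⊗ₜ[ℤ] a = 0) : a = 0 := by
  let g : A →ₗ[ℤ] A := (ℓ ^ n : ℕ) • LinearMap.id
  let T := LinearMap.ker g
  have hT : ∀ t : T, ℓ ^ n • t = 0 := fun t => Subtype.ext t.2
  let : Module (ZMod (ℓ ^ n)) T := AddCommGroup.zmodModule hT
  let : Module ℤ_[ℓ] T := Module.compHom T (PadicInt.toZModPow n)
  let φ : ℤ_[ℓ] ⊗[ℤ] T →ₗ[ℤ_[ℓ]] T := LinearMap.liftBaseChange ℤ_[ℓ] LinearMap.id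
  let t : T := ⟨a, ha⟩
  have ht : (1 : ℤ_[ℓ]) ⊗ₜ[ℤ] t = 0 := by
    apply baseChange_injective (ℓ := ℓ) (f := T.subtype) T.injective_subtype
    rw [map_zero]
    exact h
  have := congrArg φ ht
  rw [map_zero] at this
  have h2 : φ ((1 : ℤ_[ℓ]) ⊗ₜ[ℤ] t) = t := by simp [φ]
  exact congrArg Subtype.val (h2.symm.trans this)

/-- An element of `ℤ_ℓ ⊗ (P →₀ ℤ)` is determined by its coordinates. -/
theorem eq_zero_of_forall_lapply {P : Type*} {x : ℤ_[ℓ] ⊗[ℤ] (P →₀ ℤ)}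
    (h : ∀ p, (Finsupp.lapply p : (P →₀ ℤ) →ₗ[ℤ] ℤ).baseChange ℤ_[ℓ] x = 0) : x = 0 := by
  classical
  apply (TensorProduct.finsuppRight ℤ ℤ ℤ_[ℓ] ℤ P).injective
  ext p
  rw [TensorProduct.finsuppRight_apply, map_zero]
  exact h p

theorem eq_zero_of_forall_proj {P : Type*} [Finite P] {A : Type*} [AddCommGroup A]
    {x : ℤ_[ℓ] ⊗[ℤ] (P → A)}
    (h : ∀ p, (LinearMap.proj p : (P → A) →ₗ[ℤ] A).baseChange ℤ_[ℓ] x = 0) : x = 0 := by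
  classical
  have := Fintype.ofFinite P
  apply (TensorProduct.piRight ℤ ℤ ℤ_[ℓ] (fun _ : P => A)).injective
  have key : ∀ (y : ℤ_[ℓ] ⊗[ℤ] (P → A)) (p : P),
      TensorProduct.piRight ℤ ℤ ℤ_[ℓ] (fun _ : P => A) y p =
        (LinearMap.proj p : (P → A) →ₗ[ℤ] A).baseChange ℤ_[ℓ] y := by
    intro y p
    induction y using TensorProduct.induction_on with
    | zero => simp
    | tmul z a => simp
    | add y₁ y₂ h₁ h₂ => rw [map_add, map_add, Pi.add_apply, h₁, h₂]
  exact (funext fun p => (key x p).trans (h p)).trans (map_zero _).symm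

end Tensor

/-! ### `ℓ`-adic completions and local roots of unity -/

theorem mem_span_pow_smul_top {ℓ : ℕ} {A : Type*} [AddCommGroup A] {n : ℕ} {a : A} :
    a ∈ ((Ideal.span {(ℓ : ℤ)}) ^ n • ⊤ : Submodule ℤ A) ↔ ∃ b, ℓ ^ n • b = a := by
  rw [Ideal.span_singleton_pow, Submodule.ideal_span_singleton_smul,
    Submodule.mem_smul_pointwise_iff_exists]
  simp [← natCast_zsmul]

section Completion

variable {ℓ : ℕ} [Fact ℓ.Prime]

/-- An element of `lim A / ℓⁿA` divisible by every power of `ℓ` vanishes. -/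
theorem EllCompletion.eq_zero_of_divisible {ℓ : ℕ} {A : Type*} [AddCommGroup A] {x : EllCompletion ℓ A}
    (h : ∀ n : ℕ, ∃ y : EllCompletion ℓ A, ℓ ^ n • y = x) : x = 0 := by
  refine AdicCompletion.ext fun n => ?_
  obtain ⟨y, rfl⟩ := h n
  rw [← AdicCompletion.eval_apply, map_nsmul]
  obtain ⟨a, ha⟩ := Submodule.Quotient.mk_surjective _ (AdicCompletion.eval _ A n y)
  rw [← ha, ← Submodule.Quotient.mk_smul]
  exact (Submodule.Quotient.mk_eq_zero _).mpr (mem_span_pow_smul_top.mpr ⟨a, rfl⟩)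

/-- The map `ℤ_ℓ → lim ℤ / ℓⁿℤ` given by the action on `1` is injective. -/
theorem of_one_smul_injective {z : ℤ_[ℓ]}
    (hz : z • (AdicCompletion.of (Ideal.span {(ℓ : ℤ)}) ℤ 1 : EllCompletion ℓ ℤ) = 0) : z = 0 := by
  rw [← PadicInt.ext_of_toZModPow]
  intro n
  obtain ⟨m, y, rfl⟩ := exists_int_add_pow_mul z n
  rw [add_smul, mul_smul, ← Nat.cast_pow, Nat.cast_smul_eq_nsmul, Int.cast_smul_eq_zsmul,
    ← map_zsmul] at hz
  have h := congrArg (AdicCompletion.eval (Ideal.span {(ℓ : ℤ)}) ℤ n) hz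
  rw [map_add, map_nsmul, map_zero, AdicCompletion.eval_of] at h
  obtain ⟨a, ha⟩ := Submodule.Quotient.mk_surjective _ (AdicCompletion.eval (Ideal.span {(ℓ : ℤ)}) ℤ n
    (y • (AdicCompletion.of (Ideal.span {(ℓ : ℤ)}) ℤ 1 : EllCompletion ℓ ℤ)))
  rw [← ha, ← Submodule.Quotient.mk_smul, Submodule.mkQ_apply, ← Submodule.Quotient.mk_add,
    Submodule.Quotient.mk_eq_zero, mem_span_pow_smul_top] at h
  obtain ⟨b, hb⟩ := h
  have hm : (m : ℤ) = (ℓ : ℤ) ^ n * (b - a) := by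
    simp only [nsmul_eq_mul, smul_eq_mul, mul_one] at hb
    push_cast at hb
    linarith
  rw [hm]
  have : (ℓ : ZMod (ℓ ^ n)) ^ n = 0 := by
    rw [← Nat.cast_pow, ZMod.natCast_self]
  simp [this]

/-- The `ℓ`-power roots of unity of `F` already form a `ℤ_ℓ`-submodule of `ℛ_F`. -/
theorem mem_localMu_iff {F : Type*} [Field F] {x : LocalR ℓ F} :
    x ∈ localMu ℓ F ↔
      ∃ ζ : Fˣ, (∃ n : ℕ, ζ ^ ℓ ^ n = 1) ∧ x = toLocalR ℓ F (Additive.ofMul ζ) := by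
  refine ⟨fun hx => ?_, fun hx => Submodule.subset_span hx⟩
  induction hx using Submodule.span_induction with
  | mem x h => exact h
  | zero => exact ⟨1, ⟨0, one_pow _⟩, by simp⟩
  | add x y _ _ hx hy =>
    obtain ⟨ζ, ⟨n, hn⟩, rfl⟩ := hx
    obtain ⟨ξ, ⟨m, hm⟩, rfl⟩ := hy
    refine ⟨ζ * ξ, ⟨n + m, ?_⟩, by rw [ofMul_mul, map_add]⟩
    rw [mul_pow, pow_add, pow_mul, hn, one_pow, one_mul, mul_comm, pow_mul, hm, one_pow]
  | smul z x _ hx =>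
    obtain ⟨ζ, ⟨n, hn⟩, rfl⟩ := hx
    obtain ⟨m, hm⟩ := smul_eq_intCast_smul (ℓ := ℓ) (x := toLocalR ℓ F (Additive.ofMul ζ)) (n := n)
      (by rw [← map_nsmul, ← ofMul_pow, hn, ofMul_one, map_zero]) z
    refine ⟨ζ ^ m, ⟨n, ?_⟩, ?_⟩
    · rw [← zpow_natCast, zpow_comm, zpow_natCast, hn, one_zpow]
    · rw [hm, ofMul_zpow, map_zsmul]

/-- An element of `ℛ_F` that is, modulo `ℓⁿ`-th powers, an `ℓ`-power root of unity for each `n`,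
is an `ℓ`-power root of unity: either there are finitely many of these in `F`, and one of them
occurs for infinitely many `n`, or they form a divisible group, and the element is trivial. -/
theorem mem_localMu_of_forall_eval {F : Type*} [Field F] {x : LocalR ℓ F}
    (hx : ∀ n : ℕ, ∃ ζ : Fˣ, (∃ m : ℕ, ζ ^ ℓ ^ m = 1) ∧
      AdicCompletion.eval (Ideal.span {(ℓ : ℤ)}) (Additive Fˣ) n x =
        AdicCompletion.eval (Ideal.span {(ℓ : ℤ)}) (Additive Fˣ) n
          (toLocalR ℓ F (Additive.ofMul ζ))) :
    x ∈ localMu ℓ F := by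
  have hℓ : ℓ.Prime := Fact.out
  rw [mem_localMu_iff]
  by_cases hall : ∀ j : ℕ, ∃ η : Fˣ, IsPrimitiveRoot η (ℓ ^ j)
  · refine ⟨1, ⟨0, one_pow _⟩, ?_⟩
    rw [ofMul_one, map_zero]
    refine AdicCompletion.ext fun n => ?_
    obtain ⟨ζ, ⟨m, hm⟩, h⟩ := hx n
    obtain ⟨η, hη⟩ := hall (m + n)
    have hηn : IsPrimitiveRoot (η ^ ℓ ^ n) (ℓ ^ m) :=
      hη.pow (pow_pos hℓ.pos _) (by rw [pow_add, mul_comm])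
    have : NeZero (ℓ ^ m) := ⟨(pow_pos hℓ.pos _).ne'⟩
    obtain ⟨i, -, hi⟩ := (IsPrimitiveRoot.coe_units_iff.mpr hηn).eq_pow_of_pow_eq_one
      (ξ := (ζ : F)) (by rw [← Units.val_pow_eq_pow_val, hm, Units.val_one])
    rw [← Units.val_pow_eq_pow_val, Units.val_inj] at hi
    refine h.trans ?_
    rw [toLocalR, AdicCompletion.eval_of, Submodule.mkQ_apply]
    refine (Submodule.Quotient.mk_eq_zero _).mpr
      (mem_span_pow_smul_top.mpr ⟨Additive.ofMul (η ^ i), ?_⟩)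
    rw [← ofMul_pow, ← hi, ← pow_mul, ← pow_mul, mul_comm]
  · push Not at hall
    obtain ⟨j, hj⟩ := hall
    have : NeZero (ℓ ^ j) := ⟨(pow_pos hℓ.pos _).ne'⟩
    have hfin : ∀ (ζ : Fˣ) (m : ℕ), ζ ^ ℓ ^ m = 1 → ζ ∈ rootsOfUnity (ℓ ^ j) F := by
      intro ζ m hm
      obtain ⟨i, -, hi⟩ := (Nat.dvd_prime_pow hℓ).mp (orderOf_dvd_of_pow_eq_one hm)
      rw [mem_rootsOfUnity]
      apply orderOf_dvd_iff_pow_eq_one.mp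
      rw [hi]
      refine pow_dvd_pow _ ?_
      by_contra! hij
      refine hj (ζ ^ ℓ ^ (i - j)) ((IsPrimitiveRoot.orderOf ζ).pow (by rw [hi]; exact pow_pos hℓ.pos _) ?_)
      rw [hi, ← pow_add, Nat.sub_add_cancel hij.le]
    choose ζ hζ hxζ using hx
    let f : ℕ → rootsOfUnity (ℓ ^ j) F := fun n => ⟨ζ n, hfin _ _ (hζ n).choose_spec⟩
    obtain ⟨ξ, hξ⟩ := Finite.exists_infinite_fiber f
    refine ⟨ξ, ⟨j, ξ.2⟩, AdicCompletion.ext fun n => ?_⟩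
    obtain ⟨m, hm, hnm⟩ := (Set.infinite_coe_iff.mp hξ).exists_gt n
    have hm' : ζ m = ξ := congrArg Subtype.val (show f m = ξ from hm)
    rw [← AdicCompletion.transitionMap_comp_eval_apply _ _ hnm.le,
      ← AdicCompletion.transitionMap_comp_eval_apply _ _ hnm.le]
    have := hxζ m
    rw [hm'] at this
    exact congrArg _ this

end Completion

/-! ### Kummer radicals inside `F(μ_{ℓ^∞})` -/

section Cyclotomic

variable {ℓ : ℕ} [Fact ℓ.Prime] {F Ω : Type*} [Field F] [Field Ω] [Algebra F Ω]

/-- Finitely many `ℓ`-power roots of unity are powers of any primitive `ℓ^N`-th root of unity, for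
`N` large. -/
theorem adjoin_finset_le_adjoin_primitiveRoot {N₀ : ℕ} (s : Finset Ω)
    (hs : (s : Set Ω) ⊆ {ζ | ∃ n : ℕ, ζ ^ ℓ ^ n = 1}) :
    ∃ N, N₀ ≤ N ∧ ∀ ζ : Ω, IsPrimitiveRoot ζ (ℓ ^ N) →
      IntermediateField.adjoin F (s : Set Ω) ≤ IntermediateField.adjoin F {ζ} := by
  have hℓ : ℓ.Prime := Fact.out
  choose f hf using fun x : s => hs x.2
  refine ⟨N₀ + ∑ x, f x, Nat.le_add_right _ _, fun ζ hζ => ?_⟩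
  rw [IntermediateField.adjoin_le_iff]
  intro x hx
  have h1 : x ^ ℓ ^ (N₀ + ∑ x, f x) = 1 := by
    have hle : f ⟨x, hx⟩ ≤ N₀ + ∑ x, f x :=
      (Finset.single_le_sum (fun _ _ => Nat.zero_le _) (Finset.mem_univ (⟨x, hx⟩ : s))).trans
        (Nat.le_add_left _ _)
    obtain ⟨c, hc⟩ := pow_dvd_pow ℓ hle
    rw [hc, pow_mul, hf ⟨x, hx⟩, one_pow]
  have : NeZero (ℓ ^ (N₀ + ∑ x, f x)) := ⟨(pow_pos hℓ.pos _).ne'⟩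
  obtain ⟨i, -, rfl⟩ := hζ.eq_pow_of_pow_eq_one h1
  exact pow_mem (IntermediateField.mem_adjoin_simple_self F ζ) i

/-- Every element of `F(μ_{ℓ^∞})` lies in `F(ζ)` for a primitive `ℓ^N`-th root of unity `ζ`, with
`N` as large as desired. -/
theorem exists_mem_adjoin_primitiveRoot [IsAlgClosed Ω] [CharZero Ω] {y : Ω}
    (hy : y ∈ IntermediateField.adjoin F {ζ : Ω | ∃ n : ℕ, ζ ^ ℓ ^ n = 1}) (N₀ : ℕ) :
    ∃ N, N₀ ≤ N ∧ ∃ ζ : Ω, IsPrimitiveRoot ζ (ℓ ^ N) ∧ y ∈ IntermediateField.adjoin F {ζ} := by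
  have hℓ : ℓ.Prime := Fact.out
  obtain ⟨s, hs, hys⟩ : ∃ s : Finset Ω, (s : Set Ω) ⊆ {ζ : Ω | ∃ n : ℕ, ζ ^ ℓ ^ n = 1} ∧
      y ∈ IntermediateField.adjoin F (s : Set Ω) :=
    IntermediateField.exists_finset_of_mem_adjoin hy
  obtain ⟨N, hN, h⟩ := adjoin_finset_le_adjoin_primitiveRoot (F := F) (N₀ := N₀) s hs
  have : NeZero ((ℓ ^ N : ℕ) : Ω) := ⟨by exact_mod_cast (pow_pos hℓ.pos _).ne'⟩
  obtain ⟨ζ, hζ⟩ := HasEnoughRootsOfUnity.exists_primitiveRoot Ω (ℓ ^ N)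
  exact ⟨N, hN, ζ, hζ, h ζ hζ hys⟩

/-- In a field whose Galois action on the `ℓ^N`-th roots of unity is `ζ ↦ ζ^u`, the equation
`ζ^{x(u-1)} = c` is solvable if `c` is an `ℓⁿ`-th root of unity and `u` is not congruent to `1`
modulo `ℓ^{N-n}`. -/
theorem exists_zpow_mul_eq {M : Type*} [Field M] {N n : ℕ} (hn : n ≤ N) {ζ c : Mˣ}
    (hζ : IsPrimitiveRoot ζ (ℓ ^ N)) (hc : c ^ ℓ ^ n = 1) {t : ℤ}
    (ht : ¬ (ℓ : ℤ) ^ (N - n) ∣ t) : ∃ x : ℤ, ζ ^ (x * t) = c := by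
  have hℓ : ℓ.Prime := Fact.out
  have : NeZero (ℓ ^ n) := ⟨(pow_pos hℓ.pos _).ne'⟩
  have hζn : IsPrimitiveRoot (ζ ^ ℓ ^ (N - n)) (ℓ ^ n) :=
    hζ.pow (pow_pos hℓ.pos _) (by rw [← pow_add, Nat.sub_add_cancel hn])
  obtain ⟨i, -, hi⟩ := (IsPrimitiveRoot.coe_units_iff.mpr hζn).eq_pow_of_pow_eq_one
    (ξ := (c : M)) (by rw [← Units.val_pow_eq_pow_val, hc, Units.val_one])
  rw [← Units.val_pow_eq_pow_val, Units.val_inj] at hi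
  -- the greatest common divisor of `t` and `ℓ^N` divides `ℓ^{N-n}`
  have hg : (Int.gcd t ((ℓ : ℤ) ^ N) : ℤ) ∣ (ℓ : ℤ) ^ (N - n) := by
    have h1 : Int.gcd t ((ℓ : ℤ) ^ N) ∣ ℓ ^ N := by
      exact_mod_cast Int.gcd_dvd_right t ((ℓ : ℤ) ^ N)
    obtain ⟨k, -, hk⟩ := (Nat.dvd_prime_pow hℓ).mp h1
    rw [hk]
    push_cast
    refine pow_dvd_pow _ ?_
    by_contra! hlt
    refine ht ((pow_dvd_pow _ hlt.le).trans ?_)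
    have := Int.gcd_dvd_left t ((ℓ : ℤ) ^ N)
    rw [hk] at this
    exact_mod_cast this
  obtain ⟨d, hd⟩ := hg
  rw [Int.gcd_eq_gcd_ab] at hd
  refine ⟨Int.gcdA t ((ℓ : ℤ) ^ N) * d * i, ?_⟩
  have hN : ζ ^ ((ℓ : ℤ) ^ N) = 1 := by
    rw [← Nat.cast_pow, zpow_natCast]
    exact hζ.pow_eq_one
  have hexp : Int.gcdA t ((ℓ : ℤ) ^ N) * d * i * t =
      (ℓ : ℤ) ^ (N - n) * i - (ℓ : ℤ) ^ N * (Int.gcdB t ((ℓ : ℤ) ^ N) * d * i) := by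
    rw [hd]; ring
  rw [hexp, zpow_sub, zpow_mul ζ ((ℓ : ℤ) ^ N), hN, one_zpow, inv_one, mul_one, zpow_mul, ← hi,
    ← Nat.cast_pow, zpow_natCast, zpow_natCast]

/-- If a power `y^{ℓⁿ}` of an element `y` of `F(μ_{ℓ^∞})` lies in `F`, then `y` is the product of
an `ℓ`-power root of unity and an element of `F`: for `ℓ` odd the Galois group of `F(μ_{ℓ^N})/F`
is generated by one element `γ`, and `γ(y)/y` has the form `γ(ξ)/ξ` with `ξ` a root of unity, as
soon as `N` is large enough and `F` does not contain all `ℓ`-power roots of unity. -/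
theorem exists_eq_root_mul_of_pow_mem [IsAlgClosed Ω] [CharZero Ω] [Algebra.IsAlgebraic F Ω]
    (hℓ2 : ℓ ≠ 2) {y : Ω}
    (hy0 : y ≠ 0) (hy : y ∈ IntermediateField.adjoin F {ζ : Ω | ∃ n : ℕ, ζ ^ ℓ ^ n = 1})
    {n : ℕ} {a : F} (ha : y ^ ℓ ^ n = algebraMap F Ω a) :
    ∃ (ξ : Ω) (k : F), (∃ m : ℕ, ξ ^ ℓ ^ m = 1) ∧ y = ξ * algebraMap F Ω k := by
  have hℓ : ℓ.Prime := Fact.out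
  by_cases hall : ∀ j : ℕ, ∃ η : F, IsPrimitiveRoot η (ℓ ^ j)
  · obtain ⟨N, -, ζ, hζ, hyζ⟩ := exists_mem_adjoin_primitiveRoot hy 0
    obtain ⟨η, hη⟩ := hall N
    have : NeZero (ℓ ^ N) := ⟨(pow_pos hℓ.pos _).ne'⟩
    have hη' : IsPrimitiveRoot (algebraMap F Ω η) (ℓ ^ N) :=
      hη.map_of_injective (algebraMap F Ω).injective
    obtain ⟨i, -, rfl⟩ := hη'.eq_pow_of_pow_eq_one hζ.pow_eq_one
    rw [← map_pow, IntermediateField.adjoin_simple_eq_bot_iff.mpr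
      (IntermediateField.algebraMap_mem _ _)] at hyζ
    obtain ⟨k, hk⟩ := IntermediateField.mem_bot.mp hyζ
    exact ⟨1, k, ⟨0, one_pow _⟩, by rw [one_mul, hk]⟩
  · push Not at hall
    obtain ⟨j, hj⟩ := hall
    obtain ⟨N, hN, ζ₀, hζ₀, hyζ⟩ := exists_mem_adjoin_primitiveRoot hy (n + j)
    have hN0 : NeZero (ℓ ^ N) := ⟨(pow_pos hℓ.pos _).ne'⟩
    let M := IntermediateField.adjoin F {ζ₀}
    let ζ : M := ⟨ζ₀, IntermediateField.mem_adjoin_simple_self F ζ₀⟩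
    let z : M := ⟨y, hyζ⟩
    have hζ : IsPrimitiveRoot ζ (ℓ ^ N) :=
      IsPrimitiveRoot.of_map_of_injective (f := algebraMap M Ω) hζ₀ (algebraMap M Ω).injective
    have hcyc : IsCyclotomicExtension {ℓ ^ N} F M :=
      hζ₀.intermediateField_adjoin_isCyclotomicExtension F
    have hgal : IsGalois F M := IsCyclotomicExtension.isGalois {ℓ ^ N} F M
    have hfin : FiniteDimensional F M := IsCyclotomicExtension.finiteDimensional {ℓ ^ N} F M
    have hcycl : IsCyclic (M ≃ₐ[F] M) := by
      have := ZMod.isCyclic_units_of_prime_pow ℓ hℓ hℓ2 N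
      exact isCyclic_of_injective (hζ.autToPow F) (hζ.autToPow_injective F)
    -- an element of `F(ζ)` fixed by the generator `γ` lies in `F`
    obtain ⟨γ, hγ⟩ := hcycl.exists_generator
    have hfix : ∀ x : M, γ x = x → ∃ k : F, algebraMap F M k = x := by
      intro x hx
      refine (IsGalois.mem_range_algebraMap_iff_fixed x).mpr fun τ => ?_
      have hle : Subgroup.zpowers γ ≤ MulAction.stabilizer (M ≃ₐ[F] M) x := by
        rw [Subgroup.zpowers_le]
        exact hx
      exact hle (hγ τ)
    have hz0 : z ≠ 0 := fun h => hy0 (congrArg Subtype.val h)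
    set u : ℤ := ((hζ.autToPow F γ : ZMod (ℓ ^ N)).val : ℤ) with hu
    have hγζ : γ ζ = ζ ^ u := by
      rw [hu, zpow_natCast, hζ.autToPow_spec F γ]
    -- otherwise `γ`, hence the whole Galois group, would fix the `ℓ^j`-th roots of unity
    have ht : ¬ (ℓ : ℤ) ^ (N - n) ∣ u - 1 := by
      intro hdvd
      have hjN : j ≤ N - n := by omega
      have hη : IsPrimitiveRoot (ζ ^ ℓ ^ (N - j)) (ℓ ^ j) :=
        hζ.pow (pow_pos hℓ.pos _) (by rw [← pow_add, Nat.sub_add_cancel (by omega)])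
      obtain ⟨k, hk⟩ := hfix (ζ ^ ℓ ^ (N - j)) (by
        obtain ⟨d, hd⟩ := (pow_dvd_pow (ℓ : ℤ) hjN).trans hdvd
        have hu' : u = 1 + (ℓ : ℤ) ^ j * d := by linarith
        rw [map_pow, hγζ, hu', zpow_add₀ (hζ.ne_zero (NeZero.ne _)), zpow_one, mul_pow,
          ← zpow_natCast (ζ ^ _), ← zpow_mul]
        have : (ℓ : ℤ) ^ j * d * ((ℓ ^ (N - j) : ℕ) : ℤ) = ((ℓ ^ N : ℕ) : ℤ) * d := by
          have : N = j + (N - j) := by omega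
          conv_rhs => rw [this, pow_add]
          push_cast
          ring
        rw [this, zpow_mul, zpow_natCast, hζ.pow_eq_one, one_zpow, mul_one])
      refine hj k (IsPrimitiveRoot.of_map_of_injective (f := algebraMap F M) ?_
        (algebraMap F M).injective)
      rw [hk]
      exact hη
    have hza : z ^ ℓ ^ n = algebraMap F M a := Subtype.ext ha
    let ζu : Mˣ := Units.mk0 ζ (hζ.ne_zero (NeZero.ne _))
    -- `γ z / z` is an `ℓⁿ`-th root of unity, hence of the form `γ(ζ^x) / ζ^x`
    obtain ⟨x, hx⟩ := exists_zpow_mul_eq (ℓ := ℓ) (N := N) (n := n) (by omega)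
      (ζ := ζu) (c := Units.mk0 (γ z / z) (div_ne_zero (by simpa using hz0) hz0))
      (IsPrimitiveRoot.coe_units_iff.mp hζ) (by
        ext1
        rw [Units.val_pow_eq_pow_val, Units.val_mk0, div_pow, ← map_pow, hza, AlgEquiv.commutes,
          Units.val_one]
        rw [← hza]
        exact div_self (pow_ne_zero _ hz0)) ht
    have hx' : ζ ^ (x * (u - 1)) = γ z / z := by
      have := congrArg Units.val hx
      simpa [ζu] using this
    have hζ0 : ζ ≠ 0 := hζ.ne_zero (NeZero.ne _)
    obtain ⟨k, hk⟩ := hfix (z / ζ ^ x) (by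
      rw [map_div₀, map_zpow₀, hγζ, ← zpow_mul, mul_comm u x]
      rw [mul_sub, mul_one, zpow_sub₀ hζ0] at hx'
      rw [div_eq_div_iff (zpow_ne_zero _ hζ0) (zpow_ne_zero _ hζ0)]
      rw [div_eq_div_iff (zpow_ne_zero _ hζ0) hz0] at hx'
      linear_combination -hx')
    refine ⟨(ζ ^ x : M), k, ⟨N, ?_⟩, ?_⟩
    · have : ((ζ : M) ^ x) ^ ℓ ^ N = 1 := by
        rw [← zpow_natCast, zpow_comm, zpow_natCast, hζ.pow_eq_one, one_zpow]
      exact_mod_cast congrArg Subtype.val this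
    · have : z = ζ ^ x * algebraMap F M k := by
        rw [hk, mul_div_cancel₀ _ (zpow_ne_zero _ hζ0)]
      exact congrArg Subtype.val this

/-- The cyclotomic `ℤ_ℓ`-extension of `F` is contained in `F(μ_{ℓ^∞})`: each embedding of `ℚ^c` in
an algebraic closure of `F` extends to `ℚ(μ_{ℓ^∞})`. -/
theorem cyclotomicZl_le {ℓ : ℕ} (F : Type*) [Field F] [CharZero F] :
    cyclotomicZl ℓ F ≤
      IntermediateField.adjoin F {ζ : AlgebraicClosure F | ∃ n : ℕ, ζ ^ ℓ ^ n = 1} := by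
  rw [cyclotomicZl, IntermediateField.adjoin_le_iff]
  rintro _ ⟨φ, x, rfl⟩
  let : Algebra (rationalCyclotomicZl ℓ) (AlgebraicClosure F) := φ.toAlgebra
  have : Algebra.IsAlgebraic ℚ (AlgebraicClosure ℚ) := by
    -- the canonical `ℚ`-algebra structure is propositionally the one of the algebraic closure
    rw [Subsingleton.elim (DivisionRing.toRatAlgebra : Algebra ℚ (AlgebraicClosure ℚ))
      (AlgebraicClosure.instAlgebra ℚ)]
    exact AlgebraicClosure.isAlgebraic ℚ
  have : Algebra.IsAlgebraic (rationalCyclotomicZl ℓ) (AlgebraicClosure ℚ) :=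
    Algebra.IsAlgebraic.tower_top (K := ℚ) _
  let ψ : AlgebraicClosure ℚ →ₐ[rationalCyclotomicZl ℓ] AlgebraicClosure F := IsAlgClosed.lift
  have hx : (x : AlgebraicClosure ℚ) ∈ rationalCyclotomicTower ℓ :=
    (iSup_le fun E => E.2.1 : rationalCyclotomicZl ℓ ≤ rationalCyclotomicTower ℓ) x.2
  have hψ : ∀ z ∈ rationalCyclotomicTower ℓ, ψ z ∈
      IntermediateField.adjoin F {ζ : AlgebraicClosure F | ∃ n : ℕ, ζ ^ ℓ ^ n = 1} := by
    intro z hz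
    induction hz using IntermediateField.adjoin_induction with
    | mem z hz =>
      obtain ⟨n, hn⟩ := hz
      exact IntermediateField.subset_adjoin _ _ ⟨n, by rw [← map_pow, hn, map_one]⟩
    | algebraMap q =>
      have : ψ (algebraMap ℚ _ q) = (q : AlgebraicClosure F) := by simp
      rw [this]
      exact SubfieldClass.ratCast_mem _ q
    | add _ _ _ _ h₁ h₂ => rw [map_add]; exact add_mem h₁ h₂
    | mul _ _ _ _ h₁ h₂ => rw [map_mul]; exact mul_mem h₁ h₂
    | inv _ _ h => rw [map_inv₀]; exact inv_mem h
  have h1 : ψ (algebraMap (rationalCyclotomicZl ℓ) _ x) = φ x := ψ.commutes x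
  exact h1 ▸ hψ _ hx

end Cyclotomic

/-! ### Roots of unity of order prime to the residue characteristic -/

section Unramified

open Polynomial

variable {O F Ω : Type*} [CommRing O] [IsDomain O] [IsIntegrallyClosed O] [Field F] [Algebra O F]
  [IsFractionRing O F] [Field Ω] [Algebra F Ω] [Algebra O Ω] [IsScalarTower O F Ω]

/-- Distinct `q`-th roots of unity have an invertible difference where `q` is invertible. -/
theorem isUnit_sub_of_pow_eq_one {B : Type*} [CommRing B] [IsDomain B] {q : ℕ}
    (hq : IsUnit (q : B)) {α β : B} (hα : α ^ q = 1) (hβ : β ^ q = 1) (hne : α ≠ β) :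
    IsUnit (α - β) := by
  have hq0 : q ≠ 0 := by
    rintro rfl
    simp at hq
  obtain ⟨k, rfl⟩ := Nat.exists_eq_succ_of_ne_zero hq0
  set η := β * α ^ k with hη
  have hαη : α * η = β := by
    rw [hη, mul_left_comm, ← pow_succ', hα, mul_one]
  have hαu : IsUnit α := IsUnit.of_pow_eq_one hα hq0
  have hη1 : η ^ (k + 1) = 1 := by
    rw [hη, mul_pow, hβ, one_mul, ← pow_mul, mul_comm, pow_mul, hα, one_pow]
  have hηne : η - 1 ≠ 0 := fun h => hne (by rw [← hαη, sub_eq_zero.mp h, mul_one])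
  have hgeom : ∑ i ∈ Finset.range (k + 1), η ^ i = 0 := by
    refine (mul_eq_zero.mp ?_).resolve_right hηne
    rw [geom_sum_mul, hη1, sub_self]
  have hdvd : 1 - η ∣ ((k + 1 : ℕ) : B) := by
    have : ((k + 1 : ℕ) : B) = ∑ i ∈ Finset.range (k + 1), (1 - η ^ i) := by
      rw [Finset.sum_sub_distrib, hgeom, sub_zero]
      simp
    rw [this]
    exact Finset.dvd_sum fun i _ => one_sub_dvd_one_sub_pow η i
  have : α - β = α * (1 - η) := by rw [mul_sub, mul_one, hαη]
  rw [this]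
  exact hαu.mul (isUnit_of_dvd_unit hdvd hq)

/-- Lagrange interpolation at nodes with invertible differences: a polynomial of small degree all
of whose values at the nodes lie in an ideal has its coefficients in that ideal. -/
theorem exists_coeff_eq_of_eval_mem {ι B : Type*} [Fintype ι] [CommRing B] [Algebra B Ω]
    (J : Ideal B) (r c : ι → B) (hr : Function.Injective fun i => algebraMap B Ω (r i))
    (hunit : ∀ i j, i ≠ j → IsUnit (r i - r j)) (hc : ∀ i, c i ∈ J) {P : Polynomial Ω}
    (hdeg : P.degree < Fintype.card ι)
    (heval : ∀ i, P.eval (algebraMap B Ω (r i)) = algebraMap B Ω (c i)) (n : ℕ) :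
    ∃ b ∈ J, algebraMap B Ω b = P.coeff n := by
  classical
  have hu : ∀ i, IsUnit (∏ j ∈ Finset.univ.erase i, (r i - r j)) := fun i =>
    (IsUnit.prod_iff).mpr fun j hj => hunit i j (Finset.ne_of_mem_erase hj).symm
  let Q : B[X] := ∑ i, C (c i * ((hu i).unit⁻¹ : Bˣ)) * ∏ j ∈ Finset.univ.erase i, (X - C (r j))
  have hQ : Q.map (algebraMap B Ω) = P := by
    rw [Lagrange.eq_interpolate_of_eval_eq (s := Finset.univ) (v := fun i => algebraMap B Ω (r i))
      (fun i => algebraMap B Ω (c i)) hr.injOn hdeg (fun i _ => heval i),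
      Lagrange.interpolate_eq_sum, Polynomial.map_sum]
    refine Finset.sum_congr rfl fun i _ => ?_
    rw [Polynomial.map_mul, Polynomial.map_prod, Polynomial.map_C]
    congr 2
    · have h : algebraMap B Ω (∏ j ∈ Finset.univ.erase i, (r i - r j)) =
          ∏ j ∈ Finset.univ.erase i, (algebraMap B Ω (r i) - algebraMap B Ω (r j)) := by
        simp [map_prod]
      rw [← h, eq_div_iff ((hu i).map (algebraMap B Ω)).ne_zero, ← map_mul, mul_assoc,
        IsUnit.val_inv_mul, mul_one]
    · simp
  refine ⟨Q.coeff n, ?_, by rw [← hQ, coeff_map]⟩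
  have : Q ∈ J.map C := Ideal.sum_mem _ fun i _ => Ideal.mul_mem_right _ _
    (Ideal.mem_map_of_mem _ (Ideal.mul_mem_right _ _ (hc i)))
  exact Ideal.mem_map_C_iff.mp this n

/-- If `q` is invertible in `O` and `ζ` is a `q`-th root of unity, then `O[ζ]/π` is reduced for
each `π` generating a radical ideal of `O`. -/
theorem dvd_of_mem_radical_of_mem_adjoin [Normal F Ω] [CharZero F] {q : ℕ} (hq : IsUnit (q : O))
    {ζ : Ω} (hζ : ζ ^ q = 1) {π : O} (hπ0 : π ≠ 0) (hπ : ∀ (a : O) (N : ℕ), π ∣ a ^ N → π ∣ a)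
    {y : integralClosure O Ω} (hy : (y : Ω) ∈ IntermediateField.adjoin F {ζ})
    (hrad : ∃ N : ℕ, algebraMap O (integralClosure O Ω) π ∣ y ^ N) :
    algebraMap O (integralClosure O Ω) π ∣ y := by
  have hq0 : 0 < q := by
    rcases Nat.eq_zero_or_pos q with rfl | h
    · simp at hq
    · exact h
  let B := integralClosure O Ω
  have hζO : IsIntegral O ζ := IsIntegral.of_pow hq0 (by rw [hζ]; exact isIntegral_one)
  have hζF : IsIntegral F ζ := hζO.tower_top
  have hqB : IsUnit (q : B) := by simpa using hq.map (algebraMap O B)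
  let J : Ideal B := (Ideal.span {algebraMap O B π}).radical
  have hJ : ∀ z : B, z ∈ J ↔ ∃ N : ℕ, algebraMap O B π ∣ z ^ N := fun z => by
    simp only [J, Ideal.mem_radical_iff, Ideal.mem_span_singleton]
  set g := minpoly F ζ with hg
  have hgdvd : g ∣ X ^ q - 1 := minpoly.dvd F ζ (by simp [hζ])
  have hroot : ∀ r : g.rootSet Ω, (r : Ω) ^ q = 1 := by
    intro r
    obtain ⟨s, hs⟩ := hgdvd
    have := congrArg (aeval (r : Ω)) hs
    rw [map_mul, (mem_rootSet.mp r.2).2, zero_mul] at this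
    simpa [sub_eq_zero] using this
  let rB : g.rootSet Ω → B := fun r =>
    ⟨r, IsIntegral.of_pow hq0 (by rw [hroot]; exact isIntegral_one)⟩
  have hrB : ∀ r, rB r ^ q = 1 := fun r => Subtype.ext (hroot r)
  -- a polynomial representing `y` of degree less than that of `ζ`
  obtain ⟨P, hPdeg, hPy⟩ : ∃ P : F[X], P.degree < g.natDegree ∧ aeval ζ P = y := by
    rw [← IntermediateField.mem_toSubalgebra,
      IntermediateField.adjoin_simple_toSubalgebra_of_isAlgebraic hζF.isAlgebraic,
      Algebra.adjoin_singleton_eq_range_aeval] at hy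
    obtain ⟨P₀, hP₀⟩ := hy
    have hmonic := minpoly.monic hζF
    refine ⟨P₀ %ₘ g, ?_, ?_⟩
    · rw [← degree_eq_natDegree (minpoly.ne_zero hζF)]
      exact degree_modByMonic_lt _ hmonic
    · rw [aeval_modByMonic_eq_self_of_root (minpoly.aeval F ζ)]
      simpa using hP₀
  -- all conjugates of `y` lie in the radical of `π`
  have hconj : ∀ r : g.rootSet Ω, ∃ c ∈ J, aeval (r : Ω) P = algebraMap B Ω c := by
    intro r
    obtain ⟨τ', hτ'⟩ := minpoly.exists_algEquiv_of_root (K := F) hζF.isAlgebraic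
      (mem_rootSet.mp r.2).2
    obtain ⟨τ, hτ⟩ : ∃ τ : Ω ≃ₐ[F] Ω, τ ζ = r := ⟨τ'.symm, by rw [← hτ', τ'.symm_apply_apply]⟩
    let τB : B →ₐ[O] B := (τ.toAlgHom.restrictScalars O).mapIntegralClosure
    refine ⟨τB y, (hJ _).mpr ?_, ?_⟩
    · obtain ⟨N, hN⟩ := hrad
      refine ⟨N, ?_⟩
      rw [← map_pow, ← τB.commutes π]
      exact _root_.map_dvd τB hN
    · change aeval (r : Ω) P = τ y
      rw [← hPy, ← hτ]
      exact Polynomial.aeval_algHom_apply τ.toAlgHom ζ P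
  choose c hcJ hc using hconj
  have hsplit : (g.map (algebraMap F Ω)).Splits := Normal.splits inferInstance ζ
  have hcard : Fintype.card (g.rootSet Ω) = g.natDegree :=
    card_rootSet_eq_natDegree (minpoly.irreducible hζF).separable hsplit
  have hcoeff := exists_coeff_eq_of_eval_mem (Ω := Ω) J rB c Subtype.val_injective
    (fun i j hij => isUnit_sub_of_pow_eq_one hqB (hrB i) (hrB j)
      fun h => hij (Subtype.ext (congrArg (Subtype.val : B → Ω) h))) hcJ
    (P := P.map (algebraMap F Ω)) (by rw [degree_map, hcard]; exact hPdeg)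
    (fun i => by rw [eval_map_algebraMap]; exact hc i)
  -- hence so do the coefficients, which are therefore divisible by `π` in `O`
  have hd : ∀ n, ∃ d : O, P.coeff n = algebraMap O F (π * d) := by
    intro n
    obtain ⟨b, hbJ, hb⟩ := hcoeff n
    rw [coeff_map] at hb
    have hbint : IsIntegral O (P.coeff n) := by
      rw [← isIntegral_algebraMap_iff (algebraMap F Ω).injective, ← hb]
      exact b.2
    obtain ⟨a, ha⟩ := IsIntegrallyClosed.isIntegral_iff.mp hbint
    obtain ⟨N, t, ht⟩ := (hJ b).mp hbJ
    have hπF : algebraMap O F π ≠ 0 := by simpa using hπ0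
    have ht' : algebraMap F Ω (algebraMap O F a ^ N / algebraMap O F π) = t := by
      have := congrArg (algebraMap B Ω) ht
      rw [map_pow, hb, map_mul, ← ha, ← IsScalarTower.algebraMap_apply,
        ← IsScalarTower.algebraMap_apply, IsScalarTower.algebraMap_apply O F Ω π,
        IsScalarTower.algebraMap_apply O F Ω a] at this
      rw [map_div₀, map_pow, this, mul_div_cancel_left₀ _ (by simpa using hπ0)]
      rfl
    have htint : IsIntegral O (algebraMap O F a ^ N / algebraMap O F π) := by
      rw [← isIntegral_algebraMap_iff (algebraMap F Ω).injective, ht']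
      exact t.2
    obtain ⟨e, he⟩ := IsIntegrallyClosed.isIntegral_iff.mp htint
    rw [eq_div_iff hπF, ← map_mul, ← map_pow] at he
    obtain ⟨d, rfl⟩ := hπ a N ⟨e, by rw [mul_comm]; exact (IsFractionRing.injective O F he).symm⟩
    exact ⟨d, ha.symm⟩
  choose d hd using hd
  let ζB : B := ⟨ζ, hζO⟩
  refine ⟨∑ n ∈ Finset.range (P.natDegree + 1), algebraMap O B (d n) * ζB ^ n, ?_⟩
  apply Subtype.ext
  rw [← hPy, aeval_eq_sum_range, Finset.mul_sum]
  simp only [AddSubmonoidClass.coe_finsetSum]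
  refine Finset.sum_congr rfl fun n _ => ?_
  rw [hd, Algebra.smul_def, ← IsScalarTower.algebraMap_apply, map_mul, mul_assoc]
  rfl

end Unramified

/-! ### Locally cyclotomic extensions -/

section LocallyCyclotomic

open HeightOneSpectrum

variable {ℓ : ℕ} [Fact ℓ.Prime] {K L : Type*} [Field K] [NumberField K] [Field L] [NumberField L]
  [Algebra K L]

instance charZero_adicCompletion (v : HeightOneSpectrum (𝓞 K)) : CharZero (v.adicCompletion K) :=
  charZero_of_injective_algebraMap (algebraMap K (v.adicCompletion K)).injective

/-- In a locally cyclotomic extension `L_w/K_v`, an element with an `ℓⁿ`-th power in `K_v` is the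
product of a root of unity of `ℓ`-power order and an element of `K_v`. -/
theorem exists_root_mul_completionMap (hℓ2 : ℓ ≠ 2) (hlog : IsLocallyCyclotomic ℓ K L)
    (v : HeightOneSpectrum (𝓞 K)) (w : HeightOneSpectrum (𝓞 L)) [w.asIdeal.LiesOver v.asIdeal]
    {b : w.adicCompletion L} (hb : b ≠ 0) {n : ℕ} {a : v.adicCompletion K}
    (hba : b ^ ℓ ^ n = completionMap v w a) :
    ∃ (ξ : w.adicCompletion L) (k : v.adicCompletion K),
      (∃ m : ℕ, ξ ^ ℓ ^ m = 1) ∧ b = ξ * completionMap v w k := by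
  obtain ⟨σ, hσ, hσc⟩ := hlog v w
  have hσ' : ∀ x, σ (completionMap v w x) =
      algebraMap (v.adicCompletion K) (AlgebraicClosure (v.adicCompletion K)) x :=
    fun x => RingHom.congr_fun hσ x
  obtain ⟨ξ, k, ⟨m, hm⟩, h⟩ := exists_eq_root_mul_of_pow_mem (ℓ := ℓ) hℓ2
    (y := σ b) (by simpa using hb) (cyclotomicZl_le _ (hσc b)) (n := n) (a := a)
    (by rw [← map_pow, hba, hσ'])
  have hk0 : k ≠ 0 := by
    rintro rfl
    rw [map_zero, mul_zero] at h
    exact hb (by simpa using h)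
  have hk : completionMap v w k ≠ 0 := by simpa using hk0
  have hξ : σ (b / completionMap v w k) = ξ := by
    rw [map_div₀, hσ', h, mul_div_cancel_right₀ _ (by simpa using hk0)]
  refine ⟨b / completionMap v w k, k, ⟨m, ?_⟩, (div_mul_cancel₀ _ hk).symm⟩
  apply σ.injective
  rw [map_pow, hξ, hm, map_one]

theorem continuous_completionMap (v : HeightOneSpectrum (𝓞 K)) (w : HeightOneSpectrum (𝓞 L))
    [w.asIdeal.LiesOver v.asIdeal] : Continuous (completionMap v w) :=
  (adicCompletion.continuous_ofCompletion L w).comp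
    (UniformSpace.Completion.continuous_map.comp (adicCompletion.continuous_toCompletion K v))

theorem completionMap_apply_algebraMap (v : HeightOneSpectrum (𝓞 K)) (w : HeightOneSpectrum (𝓞 L))
    [w.asIdeal.LiesOver v.asIdeal] (x : K) :
    completionMap v w (algebraMap K (v.adicCompletion K) x) =
      algebraMap L (w.adicCompletion L) (algebraMap K L x) :=
  RingHom.congr_fun (completionMap_algebraMap v w) x

theorem valued_algebraMap (v : HeightOneSpectrum (𝓞 K)) (x : K) :
    Valued.v (algebraMap K (v.adicCompletion K) x) = v.valuation K x :=
  valuedAdicCompletion_eq_valuation' v x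

theorem valued_completionMap_le_one (v : HeightOneSpectrum (𝓞 K)) (w : HeightOneSpectrum (𝓞 L))
    [w.asIdeal.LiesOver v.asIdeal] {a : v.adicCompletion K} (ha : Valued.v a ≤ 1) :
    Valued.v (completionMap v w a) ≤ 1 := by
  have hU : IsOpen {x : v.adicCompletion K | Valued.v x ≤ 1} :=
    Valued.isOpen_integer (v.adicCompletion K)
  have hT : IsClosed {x : v.adicCompletion K | Valued.v (completionMap v w x) ≤ 1} :=
    (Valued.isClosed_integer (w.adicCompletion L)).preimage (continuous_completionMap v w)
  refine (closure_minimal ?_ hT) ((v.denseRange_algebraMap K).open_subset_closure_inter hU ha)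
  rintro _ ⟨hx, x, rfl⟩
  rw [Set.mem_ofPred_eq, completionMap_apply_algebraMap, valued_algebraMap,
    ← valuation_liesOver L v w]
  refine pow_le_one' ?_ _
  rw [← valued_algebraMap]
  exact hx

/-- A locally cyclotomic extension is unramified at the places prime to `ℓ`. If `e` is the
ramification index, an element `x` of `𝓞_L` that is a uniformizer at `w` and lies in all the primes
above `v` is in the radical of a uniformizer `π` of `v`. As `x` lies in an extension of `K_v` by
roots of unity of order prime to `v`, it is divisible by `π`, so that `1 = w(x) ≥ w(π) = e`. -/
theorem ramificationIdx_eq_one (hlog : IsLocallyCyclotomic ℓ K L)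
    (v : HeightOneSpectrum (𝓞 K)) (w : HeightOneSpectrum (𝓞 L)) [w.asIdeal.LiesOver v.asIdeal]
    (hv : (ℓ : 𝓞 K) ∉ v.asIdeal) : v.asIdeal.ramificationIdx' w.asIdeal = 1 := by
  obtain ⟨σ, hσ, hσc⟩ := hlog v w
  set e := v.asIdeal.ramificationIdx' w.asIdeal with he
  have he0 : e ≠ 0 := Ideal.IsDedekindDomain.ramificationIdx'_ne_zero_of_liesOver w.asIdeal v.ne_bot
  let F := v.adicCompletion K
  let O := v.adicCompletionIntegers K
  let Ω := AlgebraicClosure F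
  have hσ' : ∀ x, σ (completionMap v w x) = algebraMap F Ω x := fun x => RingHom.congr_fun hσ x
  have : IsScalarTower O F Ω := inferInstance
  have : IsIntegrallyClosed O := inferInstance
  have : IsFractionRing O F := inferInstance
  -- an element of `𝓞_L` which is a uniformizer at `w` and lies in all the primes above `v`
  obtain ⟨x, N, hxw, hxN⟩ : ∃ (x : 𝓞 L) (N : ℕ), w.intValuation x = WithZero.exp (-1 : ℤ) ∧
      x ^ N ∈ v.asIdeal.map (algebraMap (𝓞 K) (𝓞 L)) := by
    have hne : v.asIdeal.map (algebraMap (𝓞 K) (𝓞 L)) ≠ 0 := fun h => v.ne_bot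
      ((Ideal.map_eq_bot_iff_of_injective (FaithfulSMul.algebraMap_injective (𝓞 K) (𝓞 L))).mp h)
    obtain ⟨J, hJ, hwJ⟩ :=
      (FiniteMultiplicity.of_prime_left w.prime hne).exists_eq_pow_mul_and_not_dvd
    rw [Ideal.dvd_iff_le] at hwJ
    obtain ⟨j, hjJ, hjw⟩ := SetLike.not_le_iff_exists.mp hwJ
    obtain ⟨x₀, hx₀⟩ := w.intValuation_exists_uniformizer
    have hx₀w : x₀ ∈ w.asIdeal := by
      rw [← w.intValuation_lt_one_iff_mem, hx₀, ← WithZero.exp_zero, WithZero.exp_lt_exp]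
      norm_num
    set m := multiplicity w.asIdeal (v.asIdeal.map (algebraMap (𝓞 K) (𝓞 L)))
    refine ⟨x₀ * j, m + 1, ?_, ?_⟩
    · rw [map_mul, hx₀, w.intValuation_eq_one_iff.mpr hjw, mul_one]
    · rw [hJ]
      have : (x₀ * j) ^ (m + 1) = x₀ ^ m * (x₀ * j ^ m * j) := by ring
      rw [this]
      exact Ideal.mul_mem_mul (Ideal.pow_mem_pow hx₀w m) (Ideal.mul_mem_left _ _ hjJ)
  obtain ⟨π₀, hπ₀⟩ := v.intValuation_exists_uniformizer
  let π : O := algebraMap (𝓞 K) O π₀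
  have hπval : Valued.v (π : F) = WithZero.exp (-1 : ℤ) := by
    rw [← hπ₀, ← v.valuation_of_algebraMap (K := K)]
    exact valued_algebraMap v _
  have hπ0 : π ≠ 0 := by
    intro h
    rw [h] at hπval
    exact WithZero.exp_ne_zero (hπval.symm.trans (by simp))
  have hdvd : ∀ a : O, Valued.v (a : F) < 1 → π ∣ a := by
    intro a ha
    rw [← (adicCompletionIntegers.integers K v).le_iff_dvd]
    change Valued.v (a : F) ≤ Valued.v (π : F)
    rw [hπval]
    rcases eq_or_ne (Valued.v (a : F)) 0 with h0 | h0
    · rw [h0]; exact zero_le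
    rw [← WithZero.exp_log h0] at ha ⊢
    rw [← WithZero.exp_zero, WithZero.exp_lt_exp] at ha
    rw [WithZero.exp_le_exp]
    omega
  let B := integralClosure O Ω
  have hint : ∀ z : 𝓞 L, IsIntegral O (σ (algebraMap L (w.adicCompletion L) z)) := by
    intro z
    obtain ⟨p, hp, hp0⟩ := NumberField.RingOfIntegers.isIntegral_coe z
    refine ⟨p.map (Int.castRingHom O), hp.map _, ?_⟩
    have h := congrArg (σ.comp (algebraMap L (w.adicCompletion L))) hp0
    rw [Polynomial.hom_eval₂, map_zero] at h
    rw [Polynomial.eval₂_map, ← h]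
    exact congrArg₂ (fun f y => Polynomial.eval₂ f y p) (Subsingleton.elim _ _) rfl
  let g : 𝓞 L →+* B := ((σ.comp (algebraMap L (w.adicCompletion L))).comp
    (algebraMap (𝓞 L) L)).codRestrict B.toSubring hint
  have hle : v.asIdeal.map (algebraMap (𝓞 K) (𝓞 L)) ≤
      (Ideal.span {algebraMap O B π}).comap g := by
    rw [Ideal.map_le_iff_le_comap]
    intro c hc
    rw [Ideal.mem_comap, Ideal.mem_comap, Ideal.mem_span_singleton]
    have : g (algebraMap (𝓞 K) (𝓞 L) c) = algebraMap O B (algebraMap (𝓞 K) O c) := by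
      apply Subtype.ext
      change σ (algebraMap L (w.adicCompletion L) (algebraMap K L (algebraMap (𝓞 K) K c))) =
        algebraMap F Ω (algebraMap K F (algebraMap (𝓞 K) K c))
      rw [← completionMap_apply_algebraMap v w, hσ']
    rw [this]
    refine _root_.map_dvd _ (hdvd _ ?_)
    change Valued.v (algebraMap K F (algebraMap (𝓞 K) K c)) < 1
    rw [valued_algebraMap, v.valuation_of_algebraMap, v.intValuation_lt_one_iff_mem]
    exact hc
  obtain ⟨N₁, -, ζ, hζ, hxζ⟩ := exists_mem_adjoin_primitiveRoot (ℓ := ℓ) (F := F)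
    (cyclotomicZl_le F (hσc (algebraMap L (w.adicCompletion L) x))) 0
  have hunit : IsUnit ((ℓ ^ N₁ : ℕ) : O) := by
    rw [Nat.cast_pow]
    refine IsUnit.pow _ (adicCompletionIntegers.isUnit_iff_valued_eq_one.mpr ?_)
    have : (((ℓ : ℕ) : O) : F) = algebraMap K F (algebraMap (𝓞 K) K ℓ) := by simp
    rw [this, valued_algebraMap, v.valuation_of_algebraMap, v.intValuation_eq_one_iff]
    exact hv
  obtain ⟨b, hb⟩ := dvd_of_mem_radical_of_mem_adjoin (O := O) (F := F) (Ω := Ω) (q := ℓ ^ N₁)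
    (ζ := ζ) hunit hζ.pow_eq_one hπ0 (by
      rintro a M ⟨c, hc⟩
      refine hdvd a ?_
      by_contra! h
      have h1 := congrArg (fun z : O => Valued.v (z : F)) hc
      simp only [MulMemClass.coe_mul, SubmonoidClass.coe_pow, map_mul, map_pow, hπval] at h1
      have h2 : (1 : WithZero (Multiplicative ℤ)) ≤ Valued.v (a : F) ^ M := one_le_pow₀ h
      rw [h1] at h2
      have h3 : WithZero.exp (-1 : ℤ) * Valued.v (c : F) ≤ WithZero.exp (-1 : ℤ) * 1 :=
        mul_le_mul_right c.2 _
      rw [mul_one] at h3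
      have h4 := h2.trans h3
      rw [← WithZero.exp_zero, WithZero.exp_le_exp] at h4
      omega) (y := g x) hxζ
    ⟨N, by rw [← map_pow, ← Ideal.mem_span_singleton]; exact hle hxN⟩
  -- `x / π` is integral over the valuation ring of `K_v`, hence has nonnegative valuation
  let c : w.adicCompletion L := completionMap v w (π : F)
  have hc0 : c ≠ 0 := by simpa [c] using hπ0
  have hb' : σ (algebraMap L (w.adicCompletion L) x / c) = b := by
    rw [map_div₀, hσ', div_eq_iff (by simpa using hπ0), mul_comm]
    exact congrArg Subtype.val hb
  have hle1 : Valued.v (algebraMap L (w.adicCompletion L) x / c) ≤ 1 := by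
    let f : O →+* w.adicCompletionIntegers L :=
      ((completionMap v w).comp O.subtype).codRestrict (w.adicCompletionIntegers L).toSubring
        fun a => valued_completionMap_le_one v w a.2
    obtain ⟨p, hp, hp0⟩ := b.2
    refine (adicCompletionIntegers.integers L w).mem_of_integral ⟨p.map f, hp.map f, ?_⟩
    apply σ.injective
    rw [Polynomial.eval₂_map, Polynomial.hom_eval₂, map_zero, ← hp0, hb']
    refine congrArg₂ (fun f y => Polynomial.eval₂ f y p) (RingHom.ext fun a => ?_) rfl
    exact hσ' a
  have hcv : Valued.v c = WithZero.exp (-1 : ℤ) ^ e := by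
    change Valued.v (completionMap v w (algebraMap K F (algebraMap (𝓞 K) K π₀))) = _
    rw [completionMap_apply_algebraMap, valued_algebraMap, ← valuation_liesOver L v w,
      v.valuation_of_algebraMap, hπ₀]
  rw [map_div₀, valued_algebraMap, w.valuation_of_algebraMap, hxw, hcv,
    div_le_one₀ (by simp), ← WithZero.exp_nsmul, WithZero.exp_le_exp] at hle1
  simp only [nsmul_eq_mul] at hle1
  omega

end LocallyCyclotomic

/-! ### Approximation at the places above `ℓ` -/

section Approximation

open HeightOneSpectrum

universe u

variable {ℓ : ℕ} [Fact ℓ.Prime] {K : Type u} [Field K] [NumberField K]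

theorem norm_lt_norm_iff (v : HeightOneSpectrum (𝓞 K)) {x y : v.adicCompletion K} :
    ‖x‖ < ‖y‖ ↔ Valued.v x < Valued.v y := by
  rw [NumberField.FinitePlace.norm_def, NumberField.FinitePlace.norm_def, NNReal.coe_lt_coe]
  exact (WithZeroMulInt.toNNReal_strictMono
    (NumberField.HeightOneSpectrum.one_lt_absNorm_nnreal v)).lt_iff_lt

open scoped Valued in
/-- Elements of `K_v` close to `1` are `ℓ`-th powers. -/
theorem exists_pow_eq_of_close (v : HeightOneSpectrum (𝓞 K)) : ∃ N : ℕ, ∀ t : v.adicCompletion K,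
    Valued.v (t - 1) < WithZero.exp (-(N : ℤ)) → ∃ s, s ^ ℓ = t := by
  have hℓ : ℓ.Prime := Fact.out
  -- the derivative `ℓ` of `s ↦ s ^ ℓ` at `1` does not vanish, so this map is open there
  have hd := hasStrictDerivAt_pow ℓ (1 : v.adicCompletion K)
  have hmap := hd.map_nhds_eq (by simpa using hℓ.ne_zero)
  have hmem : Set.range (fun s : v.adicCompletion K => s ^ ℓ) ∈ nhds (1 : v.adicCompletion K) := by
    have := Filter.range_mem_map (f := nhds (1 : v.adicCompletion K)) (m := fun s => s ^ ℓ)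
    rw [hmap] at this
    simpa using this
  obtain ⟨ε, hε, hball⟩ := Metric.mem_nhds_iff.mp hmem
  obtain ⟨c, hc0, hcε⟩ := NormedField.exists_norm_lt (v.adicCompletion K) hε
  obtain ⟨N, hN⟩ := WithZero.exists_exp_neg_natCast_lt
    ((Valued.v.ne_zero_iff).mpr (norm_pos_iff.mp hc0) : Valued.v c ≠ 0)
  refine ⟨N, fun t ht => hball ?_⟩
  rw [mem_ball_iff_norm]
  exact ((norm_lt_norm_iff v).mpr (ht.trans hN)).trans hcε

/-- Modulo `ℓ`-th powers, an element of `K_v^×` has an integral representative, determined by its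
class modulo a fixed power of `v`. -/
theorem exists_integral_representative (v : HeightOneSpectrum (𝓞 K)) :
    ∃ e : ℕ, ∀ t : (v.adicCompletion K)ˣ, ∃ a : 𝓞 K, ∀ b : 𝓞 K, b - a ∈ v.asIdeal ^ e →
      b ≠ 0 ∧ ∃ u : (v.adicCompletion K)ˣ,
        (t : v.adicCompletion K) = algebraMap K _ (b : K) * (u : v.adicCompletion K) ^ ℓ := by
  have hℓ : ℓ.Prime := Fact.out
  have hℓ' : (0 : ℤ) < ℓ := by exact_mod_cast hℓ.pos
  obtain ⟨N, hN⟩ := exists_pow_eq_of_close (ℓ := ℓ) v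
  obtain ⟨p, hp⟩ := valuedAdicCompletion_surjective K v (WithZero.exp 1)
  obtain ⟨γ, hγ⟩ := valuedAdicCompletion_surjective K v (WithZero.exp (-((N + ℓ : ℕ) : ℤ)))
  have hp0 : p ≠ 0 := by
    rintro rfl
    rw [map_zero] at hp
    exact WithZero.exp_ne_zero hp.symm
  have hγ0 : γ ≠ 0 := by
    rintro rfl
    rw [map_zero] at hγ
    exact WithZero.exp_ne_zero hγ.symm
  refine ⟨N + ℓ + 1, fun t => ?_⟩
  -- multiply `t` by an `ℓ`-th power to bring its valuation between `0` and `ℓ - 1`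
  obtain ⟨k, ρ, hρ0, hρℓ, hkρ⟩ : ∃ (k ρ : ℤ), 0 ≤ ρ ∧ ρ < ℓ ∧
      Valued.v ((t : v.adicCompletion K) * (p ^ k) ^ ℓ) = WithZero.exp (-ρ) := by
    have h0 : Valued.v (t : v.adicCompletion K) ≠ 0 := Valued.v.ne_zero_iff.mpr t.ne_zero
    set m := WithZero.log (Valued.v (t : v.adicCompletion K)) with hm
    refine ⟨(-m) / ℓ, (-m) % ℓ, Int.emod_nonneg _ hℓ'.ne', Int.emod_lt_of_pos _ hℓ', ?_⟩
    rw [map_mul, map_pow, map_zpow₀, hp, ← WithZero.exp_log h0, ← hm, ← WithZero.exp_zsmul,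
      ← WithZero.exp_nsmul, ← WithZero.exp_add]
    congr 1
    simp only [smul_eq_mul, nsmul_eq_mul, mul_one]
    have := Int.emod_add_mul_ediv (-m) ℓ
    linarith
  set t' := (t : v.adicCompletion K) * (p ^ k) ^ ℓ with ht'
  obtain ⟨x, hx⟩ := (v.denseRange_algebraMap K).exists_dist_lt t' (norm_pos_iff.mpr hγ0)
  rw [dist_eq_norm, norm_lt_norm_iff, hγ] at hx
  have hlt1 : WithZero.exp (-((N + ℓ : ℕ) : ℤ)) < WithZero.exp (-ρ) := by
    rw [WithZero.exp_lt_exp]; push_cast; omega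
  have hρ1 : WithZero.exp (-ρ) ≤ 1 := by
    rw [← WithZero.exp_zero, WithZero.exp_le_exp]; omega
  have hx1 : v.valuation K x ≤ 1 := by
    rw [← valued_algebraMap, ← sub_sub_cancel t' (algebraMap K _ x)]
    refine (Valuation.map_sub _ _ _).trans (max_le (hkρ.trans_le hρ1) ?_)
    exact (hx.trans hlt1).le.trans hρ1
  obtain ⟨a, ha⟩ := exists_valuation_sub_lt_of_integer v hx1
    (Units.mk0 (WithZero.exp (-((N + ℓ : ℕ) : ℤ))) WithZero.exp_ne_zero)
  refine ⟨a, fun b hb => ?_⟩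
  have hb' : v.valuation K ((b : K) - x) < WithZero.exp (-((N + ℓ : ℕ) : ℤ)) := by
    have h1 : v.valuation K ((b : K) - a) < WithZero.exp (-((N + ℓ : ℕ) : ℤ)) := by
      rw [← v.intValuation_le_pow_iff_mem, ← v.valuation_of_algebraMap (K := K)] at hb
      have hba : ((b - a : 𝓞 K) : K) = (b : K) - a := map_sub (algebraMap (𝓞 K) K) b a
      rw [← hba]
      refine hb.trans_lt ?_
      rw [WithZero.exp_lt_exp]; push_cast; omega
    have : (b : K) - x = (b - a) + (a - x) := by ring
    rw [this]
    exact Valuation.map_add_lt _ h1 ha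
  have htb : Valued.v (t' - algebraMap K _ (b : K)) < WithZero.exp (-((N + ℓ : ℕ) : ℤ)) := by
    have : t' - algebraMap K _ (b : K) = (t' - algebraMap K _ x) - algebraMap K _ ((b : K) - x) := by
      rw [map_sub]; ring
    rw [this]
    refine (Valuation.map_sub _ _ _).trans_lt (max_lt hx ?_)
    rwa [valued_algebraMap]
  have hbval : Valued.v (algebraMap K (v.adicCompletion K) (b : K)) = WithZero.exp (-ρ) := by
    rw [← hkρ, ← sub_sub_cancel t' (algebraMap K _ (b : K))]
    refine Valuation.map_sub_eq_of_lt_left _ ?_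
    rw [hkρ]
    exact htb.trans hlt1
  have hb0 : algebraMap K (v.adicCompletion K) (b : K) ≠ 0 := by
    intro h
    rw [h, map_zero] at hbval
    exact WithZero.exp_ne_zero hbval.symm
  refine ⟨fun h => hb0 (by simp [h]), ?_⟩
  obtain ⟨s, hs⟩ := hN (t' / algebraMap K _ (b : K)) (by
    rw [div_sub_one hb0, map_div₀, hbval, div_lt_iff₀ (by simp), ← WithZero.exp_add]
    refine htb.trans_le ?_
    rw [WithZero.exp_le_exp]; push_cast; omega)
  rw [eq_div_iff hb0] at hs
  have hpk : p ^ k ≠ 0 := zpow_ne_zero _ hp0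
  have hs0 : s ≠ 0 := by
    rintro rfl
    rw [zero_pow hℓ.ne_zero, zero_mul] at hs
    exact mul_ne_zero t.ne_zero (pow_ne_zero _ hpk) hs.symm
  refine ⟨Units.mk0 (s / p ^ k) (div_ne_zero hs0 hpk), ?_⟩
  rw [Units.val_mk0, div_pow, mul_div_assoc', eq_div_iff (pow_ne_zero _ hpk), mul_comm _ (s ^ ℓ), hs]

theorem finite_wildPlace : Finite (WildPlace ℓ K) := by
  have hℓ : ℓ.Prime := Fact.out
  have h := Ideal.finite_factors (R := 𝓞 K) (I := Ideal.span {(ℓ : 𝓞 K)})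
    (by simpa using hℓ.ne_zero)
  refine Set.finite_coe_iff.mpr (h.subset fun v hv => ?_)
  exact (Ideal.dvd_span_singleton).mpr hv

/-- Simultaneous approximation: modulo `ℓ`-th powers in the completions at the places above `ℓ`,
finitely many elements of `K^×` represent all the families of local elements. -/
theorem exists_finite_representatives :
    ∃ (ι : Type u) (_ : Fintype ι) (g : ι → Kˣ), ∀ t : ∀ v : WildPlace ℓ K, (v.1.adicCompletion K)ˣ,
      ∃ (i : ι) (u : ∀ v : WildPlace ℓ K, (v.1.adicCompletion K)ˣ), ∀ v,
        t v = Units.map (algebraMap K (v.1.adicCompletion K)).toMonoidHom (g i) * u v ^ ℓ := by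
  classical
  have := finite_wildPlace (ℓ := ℓ) (K := K)
  have := Fintype.ofFinite (WildPlace ℓ K)
  choose e he using fun v : WildPlace ℓ K => exists_integral_representative (ℓ := ℓ) v.1
  let I : Ideal (𝓞 K) := ∏ v : WildPlace ℓ K, v.1.asIdeal ^ e v
  have hI : I ≠ ⊥ := Finset.prod_ne_zero_iff.mpr fun v _ => pow_ne_zero _ v.1.ne_bot
  have : Finite (𝓞 K ⧸ I) := Ideal.finiteQuotientOfFreeOfNeBot I hI
  refine ⟨𝓞 K ⧸ I, Fintype.ofFinite _, fun q => if h : ((q.out : 𝓞 K) : K) = 0 then 1 else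
    Units.mk0 _ h, fun t => ?_⟩
  choose a ha using fun v => he v (t v)
  obtain ⟨y, hy⟩ := IsDedekindDomain.exists_forall_sub_mem_ideal (s := Finset.univ)
    (fun v : WildPlace ℓ K => v.1.asIdeal) e (fun v _ => v.1.prime)
    (fun v _ w _ hvw h => hvw (Subtype.ext (HeightOneSpectrum.ext h))) (fun v => a v)
  set q := Ideal.Quotient.mk I y with hq
  have hqa : ∀ v, (q.out : 𝓞 K) - a v ∈ v.1.asIdeal ^ e v := by
    intro v
    have h1 : (q.out : 𝓞 K) - y ∈ I := by
      rw [← Ideal.Quotient.eq]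
      exact Ideal.Quotient.mk_out q
    have h2 : I ≤ v.1.asIdeal ^ e v := Ideal.le_of_dvd (Finset.dvd_prod_of_mem _ (Finset.mem_univ v))
    rw [← sub_add_sub_cancel _ y]
    exact add_mem (h2 h1) (hy v (Finset.mem_univ v))
  choose u hu using fun v => (ha v _ (hqa v)).2
  refine ⟨q, u, fun v => Units.ext ?_⟩
  have h0 : ((q.out : 𝓞 K) : K) ≠ 0 := by
    simpa using (ha v _ (hqa v)).1
  rw [hu v]
  beta_reduce
  rw [dif_neg h0]
  simp

/-- The map `ℛ_K → ∏_{v ∣ ℓ} ℛ_{K_v}` reaches all the families of elements of the `K_v^×`.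
Writing `t = g_i u^ℓ` with one of finitely many `g_i ∈ K^×`, then the same for `u` and so on, gives
an infinite product, which makes sense in `ℤ_ℓ ⊗ K^×` as the `g_i` are finitely many. -/
theorem exists_localize_eq (t : ∀ v : WildPlace ℓ K, (v.1.adicCompletion K)ˣ) :
    ∃ x : GlobalR ℓ K, ∀ v : WildPlace ℓ K,
      localize ℓ (algebraMap K (v.1.adicCompletion K)) x =
        toLocalR ℓ _ (Additive.ofMul (t v)) := by
  classical
  have hℓ : ℓ.Prime := Fact.out
  obtain ⟨ι, _, g, hg⟩ := exists_finite_representatives (ℓ := ℓ) (K := K)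
  choose i u hu using hg
  -- `g j` gets the exponent `∑ ℓ ^ n`, over the `n` for which it occurs in the `n`-th step
  let Z : (∀ v : WildPlace ℓ K, (v.1.adicCompletion K)ˣ) → ι → ℕ → ℤ_[ℓ] := fun t j n =>
    if i (u^[n] t) = j then (ℓ : ℤ_[ℓ]) ^ n else 0
  have hZ : ∀ t j, Summable (Z t j) := by
    intro t j
    refine Summable.of_norm_bounded (g := fun n => ((ℓ : ℝ)⁻¹) ^ n)
      (summable_geometric_of_lt_one (by positivity) (inv_lt_one_of_one_lt₀ (by
        exact_mod_cast hℓ.one_lt))) fun n => ?_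
    simp only [Z]
    split_ifs
    · simp
    · rw [norm_zero]; positivity
  have hstep : ∀ t j, ∑' n, Z t j n = (if i t = j then 1 else 0) + (ℓ : ℤ_[ℓ]) * ∑' n, Z (u t) j n := by
    intro t j
    have hsucc : ∀ n, Z t j (n + 1) = ℓ * Z (u t) j n := fun n => by
      simp only [Z, Function.iterate_succ_apply, pow_succ', mul_ite, mul_zero]
    have hzero : Z t j 0 = if i t = j then 1 else 0 := by simp [Z]
    rw [(hZ t j).tsum_eq_zero_add, hzero]
    simp only [hsucc]
    rw [(hZ (u t) j).tsum_mul_left]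
  let X : (∀ v : WildPlace ℓ K, (v.1.adicCompletion K)ˣ) → GlobalR ℓ K := fun t =>
    ∑ j, (∑' n, Z t j n) ⊗ₜ Additive.ofMul (g j)
  have hX : ∀ t, X t = 1 ⊗ₜ Additive.ofMul (g (i t)) + ℓ • X (u t) := by
    intro t
    simp only [X, hstep t, TensorProduct.add_tmul, Finset.sum_add_distrib]
    congr 1
    · rw [Finset.sum_eq_single (i t)] <;> simp +contextual [eq_comm]
    · rw [Finset.smul_sum]
      refine Finset.sum_congr rfl fun j _ => ?_
      rw [← nsmul_eq_mul, TensorProduct.smul_tmul']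
  refine ⟨X t, fun v => sub_eq_zero.mp (EllCompletion.eq_zero_of_divisible fun n => ?_)⟩
  let D : (∀ v : WildPlace ℓ K, (v.1.adicCompletion K)ˣ) → LocalR ℓ (v.1.adicCompletion K) :=
    fun t => localize ℓ (algebraMap K (v.1.adicCompletion K)) (X t) -
      toLocalR ℓ _ (Additive.ofMul (t v))
  have hD : ∀ t, D t = ℓ • D (u t) := by
    intro t
    simp only [D]
    rw [hX t, hu t v, map_add, map_nsmul, ofMul_mul, ofMul_pow, map_add, map_nsmul, smul_sub,
      add_sub_add_comm]
    have : localize ℓ (algebraMap K (v.1.adicCompletion K)) (1 ⊗ₜ Additive.ofMul (g (i t))) =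
        toLocalR ℓ _ (Additive.ofMul (Units.map
          (algebraMap K (v.1.adicCompletion K)).toMonoidHom (g (i t)))) := by
      simp [localize, unitsMap]
    rw [this, sub_self, zero_add]
  refine ⟨D (u^[n] t), ?_⟩
  change _ = D t
  induction n generalizing t with
  | zero => simp
  | succ n ih => rw [Function.iterate_succ_apply, hD t, ← ih (u t), pow_succ', mul_smul]

end Approximation

/-! ### Extension of divisors -/

section Divisors

variable {ℓ : ℕ} [Fact ℓ.Prime] {K L : Type*} [Field K] [NumberField K] [Field L] [NumberField L]
  [Algebra K L]

theorem count_coeIdeal_eq_zero (w : HeightOneSpectrum (𝓞 L)) {J : Ideal (𝓞 L)} (hJ : J ≠ ⊥)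
    (h : ¬ J ≤ w.asIdeal) : FractionalIdeal.count L w (J : FractionalIdeal (𝓞 L)⁰ L) = 0 := by
  classical
  rw [FractionalIdeal.count_coe L w hJ, Nat.cast_eq_zero]
  by_contra h0
  rw [← ne_eq, Associates.count_ne_zero_iff_dvd hJ w.irreducible] at h0
  exact h (Ideal.le_of_dvd h0)

theorem count_coeIdeal_eq_one (w : HeightOneSpectrum (𝓞 L)) {J : Ideal (𝓞 L)} (hJ : J ≠ ⊥)
    (h : J ≤ w.asIdeal) (h2 : ¬ J ≤ w.asIdeal ^ 2) :
    FractionalIdeal.count L w (J : FractionalIdeal (𝓞 L)⁰ L) = 1 := by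
  obtain ⟨I, rfl⟩ := Ideal.dvd_iff_le.mpr h
  have hI : I ≠ ⊥ := by
    rintro rfl
    exact hJ (Ideal.mul_bot _)
  rw [FractionalIdeal.coeIdeal_mul, FractionalIdeal.count_mul L w (by simpa using w.ne_bot)
    (by simpa using hI), FractionalIdeal.count_self, count_coeIdeal_eq_zero w hI, add_zero]
  intro hle
  rw [sq] at h2
  exact h2 (Ideal.mul_mono le_rfl hle)

/-- The place of `K` below a place of `L`. -/
def placeBelow (K : Type*) {L : Type*} [Field K] [NumberField K] [Field L] [NumberField L]
    [Algebra K L] (w : HeightOneSpectrum (𝓞 L)) : HeightOneSpectrum (𝓞 K) :=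
  ⟨w.asIdeal.under (𝓞 K), inferInstance, Ideal.IsIntegral.comap_ne_bot (𝓞 K) w.ne_bot⟩

instance liesOver_placeBelow (w : HeightOneSpectrum (𝓞 L)) :
    w.asIdeal.LiesOver (placeBelow K w).asIdeal := ⟨rfl⟩

theorem natCast_mem_placeBelow {w : HeightOneSpectrum (𝓞 L)} {m : ℕ} :
    (m : 𝓞 K) ∈ (placeBelow K w).asIdeal ↔ (m : 𝓞 L) ∈ w.asIdeal := by
  change algebraMap (𝓞 K) (𝓞 L) m ∈ w.asIdeal ↔ _
  rw [map_natCast]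

theorem exists_placeBelow_eq (v : HeightOneSpectrum (𝓞 K)) :
    ∃ w : HeightOneSpectrum (𝓞 L), placeBelow K w = v := by
  obtain ⟨Q, hQ, hQv⟩ := Ideal.exists_maximal_ideal_liesOver_of_isIntegral (S := 𝓞 L) v.asIdeal
  exact ⟨⟨Q, hQ.isPrime, Ideal.ne_bot_of_liesOver_of_ne_bot v.ne_bot Q⟩,
    HeightOneSpectrum.ext hQv.over.symm⟩

theorem map_asIdeal_le_iff (v : HeightOneSpectrum (𝓞 K)) (w : HeightOneSpectrum (𝓞 L)) :
    v.asIdeal.map (algebraMap (𝓞 K) (𝓞 L)) ≤ w.asIdeal ↔ placeBelow K w = v := by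
  rw [Ideal.map_le_iff_le_comap]
  refine ⟨fun h => HeightOneSpectrum.ext ?_, fun h => h ▸ le_rfl⟩
  exact (v.isMaximal.eq_of_le (placeBelow K w).isPrime.ne_top h).symm

/-- The place of `K` below a place of `L` not above `ℓ`. -/
def tamePlaceBelow (K : Type*) {L : Type*} [Field K] [NumberField K] [Field L] [NumberField L]
    [Algebra K L] (w : TamePlace ℓ L) : TamePlace ℓ K :=
  ⟨placeBelow K w.1, fun h => w.2 (natCast_mem_placeBelow.mp h)⟩

theorem tamePlaceBelow_surjective {ℓ : ℕ} :
    Function.Surjective (tamePlaceBelow K : TamePlace ℓ L → TamePlace ℓ K) := by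
  rintro ⟨v, hv⟩
  obtain ⟨w, rfl⟩ := exists_placeBelow_eq (L := L) v
  exact ⟨⟨w, fun h => hv (natCast_mem_placeBelow.mpr h)⟩, rfl⟩

/-- A locally cyclotomic extension is unramified at the places not above `ℓ`, so that the
coefficients of a divisor are preserved by extension. -/
theorem divisorExtension_apply (hlog : IsLocallyCyclotomic ℓ K L) (d : Divisor ℓ K)
    (w : TamePlace ℓ L) : divisorExtension ℓ K L d w = d (tamePlaceBelow K w) := by
  induction d using Finsupp.induction_linear with
  | zero => simp
  | add d₁ d₂ h₁ h₂ => simp [h₁, h₂]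
  | single v z =>
    have h0 : v.1.asIdeal.map (algebraMap (𝓞 K) (𝓞 L)) ≠ ⊥ := fun h =>
      v.1.ne_bot ((Ideal.map_eq_bot_iff_of_injective
        (FaithfulSMul.algebraMap_injective (𝓞 K) (𝓞 L))).mp h)
    rw [divisorExtension, Finsupp.linearCombination_single, Finsupp.smul_apply,
      idealDivisor_apply, smul_eq_mul]
    by_cases hv : placeBelow K w.1 = v.1
    · have : w.1.asIdeal.LiesOver v.1.asIdeal := hv ▸ liesOver_placeBelow w.1
      have he := ramificationIdx_eq_one hlog v.1 w.1 v.2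
      have hle := (map_asIdeal_le_iff v.1 w.1).mpr hv
      rw [count_coeIdeal_eq_one w.1 h0 hle, show tamePlaceBelow K w = v from Subtype.ext hv,
        Finsupp.single_eq_same, Int.cast_one, mul_one]
      intro hle2
      rw [Ideal.IsDedekindDomain.ramificationIdx'_eq_multiplicity h0 w.1.isPrime] at he
      exact (FiniteMultiplicity.of_prime_left w.1.prime h0).not_pow_dvd_of_multiplicity_lt
        (by omega) (Ideal.dvd_iff_le.mpr hle2)
    · rw [count_coeIdeal_eq_zero w.1 h0 (fun h => hv ((map_asIdeal_le_iff v.1 w.1).mp h)),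
        Finsupp.single_eq_of_ne (fun h => hv (congrArg Subtype.val h)), Int.cast_zero, mul_zero]

theorem divisorExtension_injective (hlog : IsLocallyCyclotomic ℓ K L) :
    Function.Injective (divisorExtension ℓ K L) := by
  intro d₁ d₂ h
  ext v
  obtain ⟨w, rfl⟩ := tamePlaceBelow_surjective (L := L) v
  rw [← divisorExtension_apply hlog, h, divisorExtension_apply hlog]

/-- The cokernel of the extension of divisors has no `ℓ`-power torsion. -/
theorem exists_divisorExtension_eq (hlog : IsLocallyCyclotomic ℓ K L) {n : ℕ} {D : Divisor ℓ L}
    {d : Divisor ℓ K} (h : ℓ ^ n • D = divisorExtension ℓ K L d) :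
    ∃ d', divisorExtension ℓ K L d' = D := by
  have hℓ : ℓ.Prime := Fact.out
  have hℓn : ((ℓ ^ n : ℕ) : ℤ_[ℓ]) ≠ 0 := by exact_mod_cast (pow_pos hℓ.pos n).ne'
  choose s hs using tamePlaceBelow_surjective (ℓ := ℓ) (K := K) (L := L)
  -- choose one place `s v` above each `v`
  refine ⟨D.comapDomain s (Function.LeftInverse.injective hs).injOn, ?_⟩
  ext w
  rw [divisorExtension_apply hlog, Finsupp.comapDomain_apply]
  have key : ∀ w', ((ℓ ^ n : ℕ) : ℤ_[ℓ]) * D w' = d (tamePlaceBelow K w') := fun w' => by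
    rw [← divisorExtension_apply hlog, ← h, Finsupp.smul_apply, nsmul_eq_mul]
  apply mul_left_cancel₀ hℓn
  rw [key, key, hs]

end Divisors

/-! ### Galois descent -/

section GaloisAction

variable {ℓ : ℕ} [Fact ℓ.Prime] {K L : Type*} [Field K] [Field L] [Algebra K L]

/-- The action of `Gal(L/K)` on `ℛ_L`. -/
def galoisAction (ℓ : ℕ) [Fact ℓ.Prime] {K L : Type*} [Field K] [Field L] [Algebra K L]
    (σ : L ≃ₐ[K] L) : GlobalR ℓ L →ₗ[ℤ_[ℓ]] GlobalR ℓ L :=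
  (unitsMap (σ : L →+* L)).baseChange ℤ_[ℓ]

theorem galoisAction_one_tmul (σ : L ≃ₐ[K] L) (a : Lˣ) :
    galoisAction ℓ σ (1 ⊗ₜ Additive.ofMul a) = 1 ⊗ₜ Additive.ofMul (σ • a) := by
  rw [galoisAction, LinearMap.baseChange_tmul]
  rfl

theorem galoisAction_mul (σ τ : L ≃ₐ[K] L) (x : GlobalR ℓ L) :
    galoisAction ℓ (σ * τ) x = galoisAction ℓ σ (galoisAction ℓ τ x) := by
  rw [galoisAction, galoisAction, galoisAction, ← LinearMap.comp_apply, ← LinearMap.baseChange_comp]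
  rfl

theorem galoisAction_globalExtension (σ : L ≃ₐ[K] L) (x : GlobalR ℓ K) :
    galoisAction ℓ σ (globalExtension ℓ K L x) = globalExtension ℓ K L x := by
  rw [galoisAction, globalExtension, ← LinearMap.comp_apply, ← LinearMap.baseChange_comp]
  congr 2
  exact LinearMap.ext fun a => congrArg Additive.ofMul (Units.ext (σ.commutes _))

/-- `ℛ_K` is the module of Galois invariants of `ℛ_L`. -/
theorem exists_globalExtension_eq [FiniteDimensional K L] [IsGalois K L] {x : GlobalR ℓ L}
    (h : ∀ σ : L ≃ₐ[K] L, galoisAction ℓ σ x = x) : ∃ y, globalExtension ℓ K L y = x := by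
  let g : Additive Lˣ →ₗ[ℤ] ((L ≃ₐ[K] L) → Additive Lˣ) :=
    LinearMap.pi fun σ => unitsMap ((σ : L ≃ₐ[K] L) : L →+* L) - LinearMap.id
  refine mem_range_baseChange (g := g) (fun a => ⟨fun ha => ?_, ?_⟩) (eq_zero_of_forall_proj fun σ => ?_)
  · have hfix : ∀ σ : L ≃ₐ[K] L, σ (a.toMul : L) = a.toMul := fun σ =>
      congrArg (fun b : Additive Lˣ => (b.toMul : L)) (sub_eq_zero.mp (congrFun ha σ))
    obtain ⟨b, hb⟩ := (IsGalois.mem_range_algebraMap_iff_fixed (F := K) (a.toMul : L)).mpr hfix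
    have hb0 : b ≠ 0 := by
      rintro rfl
      rw [map_zero] at hb
      exact a.toMul.ne_zero hb.symm
    exact ⟨Additive.ofMul (Units.mk0 b hb0), congrArg Additive.ofMul (Units.ext hb)⟩
  · rintro ⟨b, rfl⟩
    funext σ
    exact sub_eq_zero.mpr (congrArg Additive.ofMul (Units.ext (σ.commutes _)))
  · rw [← LinearMap.comp_apply, ← LinearMap.baseChange_comp, LinearMap.proj_pi,
      LinearMap.baseChange_sub, LinearMap.sub_apply, LinearMap.baseChange_id, LinearMap.id_apply]
    exact sub_eq_zero.mpr (h σ)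

end GaloisAction

section Galois

variable {ℓ : ℕ} [Fact ℓ.Prime] {K L M : Type*} [Field K] [NumberField K] [Field L] [NumberField L]
  [Field M] [NumberField M] [Algebra K L] [Algebra L M] [Algebra K M] [IsScalarTower K L M]

theorem divisorExtension_divisorExtension (d : Divisor ℓ K) :
    divisorExtension ℓ L M (divisorExtension ℓ K L d) = divisorExtension ℓ K M d := by
  induction d using Finsupp.induction_linear with
  | zero => simp
  | add d₁ d₂ h₁ h₂ => simp only [map_add, h₁, h₂]
  | single v z =>
    have h0 : v.1.asIdeal.map (algebraMap (𝓞 K) (𝓞 L)) ≠ ⊥ := fun h =>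
      v.1.ne_bot ((Ideal.map_eq_bot_iff_of_injective
        (FaithfulSMul.algebraMap_injective (𝓞 K) (𝓞 L))).mp h)
    rw [divisorExtension.eq_def ℓ K L, divisorExtension.eq_def ℓ K M,
      Finsupp.linearCombination_single, Finsupp.linearCombination_single, map_smul,
      divisorExtension_idealDivisor ℓ L M _ h0, Ideal.map_map]
    congr 5
    ext x
    exact (IsScalarTower.algebraMap_apply K L M x).symm

theorem galoisAction_mem {K : Type*} [Field K] [Algebra K L] (σ : L ≃ₐ[K] L) {x : GlobalR ℓ L} (hx : x ∈ pseudoInfinitesimal ℓ L) :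
    galoisAction ℓ σ x ∈ pseudoInfinitesimal ℓ L :=
  @globalExtension_mem ℓ _ L L _ _ _ _ (σ : L →+* L).toAlgebra x hx

/-- If the divisor of `x` comes from `K`, then `σ x` and `x` have the same divisor: functoriality
for the algebra structure on `L` given by `σ : L → L`, which fixes the divisors coming from `K`. -/
theorem divisorMap_galoisAction (σ : L ≃ₐ[K] L) {x : GlobalR ℓ L} {d : Divisor ℓ K}
    (h : divisorExtension ℓ K L d = divisorMap ℓ L x) :
    divisorMap ℓ L (galoisAction ℓ σ x) = divisorMap ℓ L x := by
  have h1 := @divisorExtension_divisorMap ℓ _ L L _ _ _ _ (σ : L →+* L).toAlgebra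
  have h2 := @divisorExtension_divisorExtension ℓ _ K L L _ _ _ _ _ _ _
    (σ : L →+* L).toAlgebra _ (@IsScalarTower.of_algebraMap_eq K L L _ _ _ _
      (σ : L →+* L).toAlgebra _ (fun a => (σ.commutes a).symm)) d
  refine (LinearMap.congr_fun h1 x).symm.trans ?_
  rw [LinearMap.comp_apply, ← h]
  exact h2

end Galois

/-! ### Pseudo-infinitesimal elements with trivial divisor -/

section Orders

variable (K : Type*) [Field K] [NumberField K]

/-- The family of the orders of an element of `K^×` at all finite places. -/
def orders : Additive Kˣ →ₗ[ℤ] (HeightOneSpectrum (𝓞 K) →₀ ℤ) :=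
  AddMonoidHom.toIntLinearMap
  { toFun := fun a => Finsupp.ofSupportFinite
      (fun v => FractionalIdeal.count K v (FractionalIdeal.spanSingleton (𝓞 K)⁰ (a.toMul : K)))
      (Filter.eventually_cofinite.mp (FractionalIdeal.finite_factors _))
    map_zero' := by
      ext v
      simp [Finsupp.ofSupportFinite_coe, FractionalIdeal.count_one]
    map_add' := fun a b => by
      ext v
      refine Eq.trans ?_ (FractionalIdeal.count_mul K v
        (FractionalIdeal.spanSingleton_ne_zero_iff.mpr a.toMul.ne_zero)
        (FractionalIdeal.spanSingleton_ne_zero_iff.mpr b.toMul.ne_zero))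
      rw [FractionalIdeal.spanSingleton_mul_spanSingleton]
      rfl }

variable {K}

theorem orders_apply (a : Additive Kˣ) (v : HeightOneSpectrum (𝓞 K)) :
    orders K a v =
      FractionalIdeal.count K v (FractionalIdeal.spanSingleton (𝓞 K)⁰ (a.toMul : K)) := rfl

theorem valuation_eq_exp_orders (a : Additive Kˣ) (v : HeightOneSpectrum (𝓞 K)) :
    v.valuation K (a.toMul : K) = WithZero.exp (-orders K a v) := by
  obtain ⟨x, y, hy, hxy⟩ := IsFractionRing.div_surjective (A := 𝓞 K) (a.toMul : K)
  have hy0 : y ≠ 0 := nonZeroDivisors.ne_zero hy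
  have hx0 : x ≠ 0 := by
    rintro rfl
    rw [map_zero, zero_div] at hxy
    exact a.toMul.ne_zero hxy.symm
  rw [orders_apply, FractionalIdeal.count_well_defined K v
    (FractionalIdeal.spanSingleton_ne_zero_iff.mpr a.toMul.ne_zero) (a := y) (J := Ideal.span {x})
    (by rw [FractionalIdeal.coeIdeal_span_singleton, FractionalIdeal.spanSingleton_mul_spanSingleton,
      ← hxy, div_eq_inv_mul]), ← hxy, map_div₀, v.valuation_of_algebraMap, v.valuation_of_algebraMap,
    v.intValuation_if_neg hx0, v.intValuation_if_neg hy0, ← WithZero.exp_sub]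
  congr 1
  ring

/-- The units of `𝓞 K` are the elements of `K^×` of order `0` at all finite places. -/
theorem exact_units_orders : Function.Exact (unitsMap (algebraMap (𝓞 K) K)) (orders K) := by
  intro a
  constructor
  · intro ha
    have hval : ∀ v : HeightOneSpectrum (𝓞 K), v.valuation K (a.toMul : K) = 1 := fun v => by
      rw [valuation_eq_exp_orders, ha, Finsupp.zero_apply, neg_zero, WithZero.exp_zero]
    obtain ⟨x, hx⟩ := HeightOneSpectrum.mem_integers_of_valuation_le_one K (a.toMul : K)
      fun v => (hval v).le
    obtain ⟨y, hy⟩ := HeightOneSpectrum.mem_integers_of_valuation_le_one K ((a.toMul : K)⁻¹)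
      fun v => by rw [map_inv₀, hval, inv_one]
    have hxy : x * y = 1 := by
      apply FaithfulSMul.algebraMap_injective (𝓞 K) K
      rw [map_mul, hx, hy, map_one, mul_inv_cancel₀ a.toMul.ne_zero]
    exact ⟨Additive.ofMul (Units.mkOfMulEqOne x y hxy), congrArg Additive.ofMul (Units.ext hx)⟩
  · rintro ⟨u, rfl⟩
    ext v
    have h1 : ∀ u : Additive (𝓞 K)ˣ, 0 ≤ orders K (unitsMap (algebraMap (𝓞 K) K) u) v := fun u => by
      have h := valuation_eq_exp_orders (unitsMap (algebraMap (𝓞 K) K) u) v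
      have h2 : v.valuation K (algebraMap (𝓞 K) K (u.toMul : 𝓞 K)) ≤ 1 := v.valuation_le_one _
      rw [show ((unitsMap (algebraMap (𝓞 K) K) u).toMul : K) =
        algebraMap (𝓞 K) K (u.toMul : 𝓞 K) from rfl] at h
      rw [h, ← WithZero.exp_zero, WithZero.exp_le_exp] at h2
      omega
    have h3 := h1 (-u)
    rw [map_neg, map_neg, Finsupp.neg_apply, Left.nonneg_neg_iff] at h3
    exact le_antisymm h3 (h1 u)

end Orders

section Kernel

variable {ℓ : ℕ} [Fact ℓ.Prime] {K : Type*} [Field K] [NumberField K]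

/-- The order at a finite place, extended to a `ℤ_ℓ`-linear map on `ℛ_K`. -/
def orderAt (ℓ : ℕ) [Fact ℓ.Prime] (v : HeightOneSpectrum (𝓞 K)) : GlobalR ℓ K →ₗ[ℤ_[ℓ]] ℤ_[ℓ] :=
  LinearMap.liftBaseChange ℤ_[ℓ] ((Algebra.linearMap ℤ ℤ_[ℓ]).comp ((Finsupp.lapply v).comp (orders K)))

theorem orderAt_tmul (v : HeightOneSpectrum (𝓞 K)) (z : ℤ_[ℓ]) (a : Additive Kˣ) :
    orderAt ℓ v (z ⊗ₜ a) = z * (orders K a v : ℤ) := by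
  simp [orderAt]

theorem divisorMap_apply (x : GlobalR ℓ K) (v : TamePlace ℓ K) :
    divisorMap ℓ K x v = orderAt ℓ v.1 x := by
  induction x using TensorProduct.induction_on with
  | zero => simp
  | add x y hx hy => rw [map_add, Finsupp.add_apply, hx, hy, map_add]
  | tmul z a =>
    rw [orderAt_tmul, divisorMap, LinearMap.liftBaseChange_tmul]
    rfl

theorem orders_baseChange_eq_zero {x : GlobalR ℓ K} (h : ∀ v, orderAt ℓ v x = 0) :
    (orders K).baseChange ℤ_[ℓ] x = 0 := by
  refine eq_zero_of_forall_lapply fun v => ?_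
  apply (TensorProduct.AlgebraTensorModule.rid ℤ ℤ_[ℓ] ℤ_[ℓ]).injective
  rw [map_zero, ← h v, ← LinearMap.comp_apply, ← LinearEquiv.coe_coe, ← LinearMap.comp_apply]
  congr 1
  ext a
  simp [orderAt]

open WithZero in
/-- The additive valuation on a completion. -/
def localOrder (v : HeightOneSpectrum (𝓞 K)) : Additive (v.adicCompletion K)ˣ →ₗ[ℤ] ℤ :=
  AddMonoidHom.toIntLinearMap
  { toFun := fun t => -log (Valued.v (t.toMul : v.adicCompletion K))
    map_zero' := by simp
    map_add' := fun s t => by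
      rw [toMul_add, Units.val_mul, map_mul, log_mul (Valued.v.ne_zero_iff.mpr s.toMul.ne_zero)
        (Valued.v.ne_zero_iff.mpr t.toMul.ne_zero)]
      ring }

theorem localOrder_unitsMap (v : HeightOneSpectrum (𝓞 K)) (a : Additive Kˣ) :
    localOrder v (unitsMap (algebraMap K (v.adicCompletion K)) a) = orders K a v := by
  change -WithZero.log (Valued.v (algebraMap K (v.adicCompletion K) (a.toMul : K))) = _
  rw [valued_algebraMap, valuation_eq_exp_orders, WithZero.log_exp, neg_neg]

/-- The additive valuation on the completed multiplicative group of a local field. -/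
def completedOrder (ℓ : ℕ) [Fact ℓ.Prime] (v : HeightOneSpectrum (𝓞 K)) :
    LocalR ℓ (v.adicCompletion K) →ₗ[ℤ_[ℓ]] EllCompletion ℓ ℤ where
  toFun := AdicCompletion.map (Ideal.span {(ℓ : ℤ)}) (localOrder v)
  map_add' := map_add _
  map_smul' z x := map_smul (AdicCompletion.map (Ideal.span {(ℓ : ℤ)}) (localOrder v))
    (padicToCompletion ℓ z) x

theorem completedOrder_toLocalR (v : HeightOneSpectrum (𝓞 K)) (t : Additive (v.adicCompletion K)ˣ) :
    completedOrder ℓ v (toLocalR ℓ _ t) = AdicCompletion.of (Ideal.span {(ℓ : ℤ)}) ℤ (localOrder v t) :=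
  AdicCompletion.map_of _ _ _

theorem completedOrder_localize (v : HeightOneSpectrum (𝓞 K)) (x : GlobalR ℓ K) :
    completedOrder ℓ v (localize ℓ (algebraMap K (v.adicCompletion K)) x) =
      orderAt ℓ v x • (AdicCompletion.of (Ideal.span {(ℓ : ℤ)}) ℤ 1 : EllCompletion ℓ ℤ) := by
  induction x using TensorProduct.induction_on with
  | zero => simp
  | add x y hx hy => rw [map_add, map_add, map_add, hx, hy, add_smul]
  | tmul z a =>
    rw [localize, LinearMap.liftBaseChange_tmul, map_smul, LinearMap.comp_apply,
      completedOrder_toLocalR, localOrder_unitsMap, orderAt_tmul, mul_smul, Int.cast_smul_eq_zsmul,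
      ← map_zsmul, smul_eq_mul, mul_one]

/-- Pseudo-infinitesimal elements have order `0` at the places above `ℓ`, since roots of unity do
in the completions. -/
theorem orderAt_eq_zero_of_mem {x : GlobalR ℓ K} (hx : x ∈ pseudoInfinitesimal ℓ K)
    (v : WildPlace ℓ K) : orderAt ℓ v.1 x = 0 := by
  have hℓ : ℓ.Prime := Fact.out
  simp only [pseudoInfinitesimal, Submodule.mem_iInf, Submodule.mem_comap] at hx
  obtain ⟨ζ, ⟨n, hn⟩, hζ⟩ := mem_localMu_iff.mp (hx v)
  apply of_one_smul_injective
  rw [← completedOrder_localize, hζ, completedOrder_toLocalR]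
  have h : ℓ ^ n • localOrder v.1 (Additive.ofMul ζ) = 0 := by
    rw [← map_nsmul, ← ofMul_pow, hn, ofMul_one, map_zero]
  rw [(smul_eq_zero.mp h).resolve_left (pow_pos hℓ.pos n).ne', map_zero]

/-- Under Leopoldt's conjecture, the pseudo-infinitesimal elements with trivial divisor are the
roots of unity of `ℓ`-power order. -/
theorem exists_root_of_divisorMap_eq_zero (hleo : LeopoldtConjecture ℓ K) {x : GlobalR ℓ K}
    (hx : x ∈ pseudoInfinitesimal ℓ K) (hd : divisorMap ℓ K x = 0) :
    ∃ ζ : globalMu ℓ K, x = 1 ⊗ₜ Additive.ofMul (ζ : Kˣ) := by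
  classical
  have := finite_wildPlace (ℓ := ℓ) (K := K)
  have := Fintype.ofFinite (WildPlace ℓ K)
  obtain ⟨y, rfl⟩ := mem_range_baseChange
    (f := unitsMap (algebraMap (𝓞 K) K)) exact_units_orders (orders_baseChange_eq_zero fun v => by
    by_cases hv : (ℓ : 𝓞 K) ∈ v.asIdeal
    · exact orderAt_eq_zero_of_mem hx ⟨v, hv⟩
    · rw [← divisorMap_apply x ⟨v, hv⟩, hd, Finsupp.zero_apply])
  simp only [pseudoInfinitesimal, Submodule.mem_iInf, Submodule.mem_comap, mem_localMu_iff] at hx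
  choose ζ hζ hxζ using hx
  choose n hn using hζ
  -- locally at `ℓ`, the element is killed by `ℓ ^ n v`
  have hy : ℓ ^ (∑ v, n v) • y = 0 := by
    refine hleo ?_
    rw [map_zero]
    funext v
    rw [map_nsmul, Pi.smul_apply, LinearMap.pi_apply, LinearMap.comp_apply, hxζ v, ← map_nsmul,
      ← ofMul_pow, ← Finset.add_sum_erase _ _ (Finset.mem_univ v), pow_add, pow_mul, hn, one_pow]
    simp
  obtain ⟨a, ha, hxa⟩ := exists_one_tmul_eq (ℓ := ℓ) (n := ∑ v, n v)
    (x := (unitsMap (algebraMap (𝓞 K) K)).baseChange ℤ_[ℓ] y) (by rw [← map_nsmul, hy, map_zero])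
  exact ⟨⟨a.toMul, CommMonoid.mem_primaryComponent.mpr ⟨_, congrArg Additive.toMul ha⟩⟩, hxa⟩

end Kernel

/-! ### Descent of pseudo-infinitesimal elements -/

section Descent

variable {ℓ : ℕ} [Fact ℓ.Prime] {K L : Type*} [Field K] [NumberField K] [Field L] [NumberField L]
  [Algebra K L]

/-- In a locally cyclotomic extension, an element of `ℛ_{K_v}` that becomes a root of unity in
`ℛ_{L_w}` is a root of unity. -/
theorem mem_localMu_of_localExtension_mem (hℓ2 : ℓ ≠ 2) (hlog : IsLocallyCyclotomic ℓ K L)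
    (v : HeightOneSpectrum (𝓞 K)) (w : HeightOneSpectrum (𝓞 L)) [w.asIdeal.LiesOver v.asIdeal]
    {x : LocalR ℓ (v.adicCompletion K)}
    (hx : localExtension ℓ (completionMap v w) x ∈ localMu ℓ (w.adicCompletion L)) :
    x ∈ localMu ℓ (v.adicCompletion K) := by
  obtain ⟨ζ, ⟨s, hs⟩, hζ⟩ := mem_localMu_iff.mp hx
  refine mem_localMu_of_forall_eval fun n => ?_
  obtain ⟨a, ha⟩ := Submodule.mkQ_surjective _
    (AdicCompletion.eval (Ideal.span {(ℓ : ℤ)}) (Additive (v.adicCompletion K)ˣ) n x)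
  -- modulo `ℓⁿ`-th powers, `x` is the class of `a`, and `a = ζ b ^ (ℓ ^ n)` in `L_w`
  have h1 : Submodule.mkQ ((Ideal.span {(ℓ : ℤ)}) ^ n • (⊤ : Submodule ℤ
        (Additive (w.adicCompletion L)ˣ))) (unitsMap (completionMap v w) a) =
      Submodule.mkQ _ (Additive.ofMul ζ) := by
    have h2 := congrArg (AdicCompletion.eval (Ideal.span {(ℓ : ℤ)}) _ n) hζ
    refine Eq.trans ?_ h2
    change _ = (unitsMap (completionMap v w)).reduceModIdeal ((Ideal.span {(ℓ : ℤ)}) ^ n)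
      (AdicCompletion.eval (Ideal.span {(ℓ : ℤ)}) _ n x)
    rw [← ha]
    rfl
  rw [Submodule.mkQ_apply, Submodule.mkQ_apply, Submodule.Quotient.eq, mem_span_pow_smul_top] at h1
  obtain ⟨b, hb⟩ := h1
  have hb' : completionMap v w (a.toMul : v.adicCompletion K) =
      ζ * (b.toMul : w.adicCompletion L) ^ ℓ ^ n :=
    congrArg (fun t : Additive (w.adicCompletion L)ˣ => (t.toMul : w.adicCompletion L))
      (sub_eq_iff_eq_add'.mp hb.symm)
  have hs' : (ζ : w.adicCompletion L) ^ ℓ ^ s = 1 := by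
    rw [← Units.val_pow_eq_pow_val, hs, Units.val_one]
  obtain ⟨ξ, k, ⟨m, hm⟩, hξ⟩ := exists_root_mul_completionMap hℓ2 hlog v w b.toMul.ne_zero
    (n := n + s) (a := (a.toMul : v.adicCompletion K) ^ ℓ ^ s) (by
      rw [map_pow, hb', mul_pow, hs', one_mul, ← pow_mul, ← pow_add])
  have hk0 : k ≠ 0 := by
    rintro rfl
    rw [map_zero, mul_zero] at hξ
    exact b.toMul.ne_zero hξ
  refine ⟨a.toMul / Units.mk0 k hk0 ^ ℓ ^ n, ⟨s + m, ?_⟩, ?_⟩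
  · apply Units.ext
    apply (completionMap v w).injective
    rw [Units.val_pow_eq_pow_val, Units.val_div_eq_div_val, Units.val_pow_eq_pow_val, Units.val_mk0,
      map_pow, map_div₀, map_pow, hb', hξ, mul_pow, ← mul_assoc,
      mul_div_cancel_right₀ _ (pow_ne_zero _ (by simpa using hk0)), mul_pow, pow_add, pow_mul, hs',
      one_pow, one_mul, ← pow_mul, mul_comm, mul_comm (ℓ ^ s), pow_mul, pow_mul, hm, one_pow,
      one_pow, Units.val_one, map_one]
  · rw [← ha, toLocalR, AdicCompletion.eval_of, Submodule.mkQ_apply, Submodule.mkQ_apply,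
      Submodule.Quotient.eq, mem_span_pow_smul_top]
    refine ⟨Additive.ofMul (Units.mk0 k hk0), ?_⟩
    rw [ofMul_div, ofMul_pow, ofMul_toMul, sub_sub_cancel]

theorem localize_globalExtension_apply (v : HeightOneSpectrum (𝓞 K)) (w : HeightOneSpectrum (𝓞 L))
    [w.asIdeal.LiesOver v.asIdeal] (x : GlobalR ℓ K) :
    localize ℓ (algebraMap L (w.adicCompletion L)) (globalExtension ℓ K L x) =
      localExtension ℓ (completionMap v w) (localize ℓ (algebraMap K (v.adicCompletion K)) x) := by
  rw [← LinearMap.comp_apply, localize_globalExtension, ← completionMap_algebraMap v w,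
    ← localExtension_localize, LinearMap.comp_apply]

/-- In a locally cyclotomic extension, an element of `ℛ_K` that becomes pseudo-infinitesimal in
`ℛ_L` is pseudo-infinitesimal. -/
theorem mem_pseudoInfinitesimal_of_globalExtension_mem (hℓ2 : ℓ ≠ 2)
    (hlog : IsLocallyCyclotomic ℓ K L) {x : GlobalR ℓ K}
    (hx : globalExtension ℓ K L x ∈ pseudoInfinitesimal ℓ L) : x ∈ pseudoInfinitesimal ℓ K := by
  simp only [pseudoInfinitesimal, Submodule.mem_iInf, Submodule.mem_comap] at hx ⊢
  rintro ⟨v, hv⟩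
  obtain ⟨w, rfl⟩ := exists_placeBelow_eq (L := L) v
  refine mem_localMu_of_localExtension_mem hℓ2 hlog _ w ?_
  rw [← localize_globalExtension_apply]
  exact hx ⟨w, natCast_mem_placeBelow.mp hv⟩

/-- If `σ x - x` is a root of unity for all `σ`, then some multiple of `x` comes from `ℛ_K`. -/
theorem exists_globalExtension_eq_pow_smul [IsGalois K L] {x : GlobalR ℓ L}
    {c : (L ≃ₐ[K] L) → globalMu ℓ L}
    (hc : ∀ σ, galoisAction ℓ σ x - x = 1 ⊗ₜ Additive.ofMul (c σ : Lˣ)) :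
    ∃ (n : ℕ) (y : GlobalR ℓ K), globalExtension ℓ K L y = ℓ ^ n • x := by
  classical
  have := FiniteDimensional.right ℚ K L
  choose n hn using fun σ => CommMonoid.mem_primaryComponent.mp (c σ).2
  refine ⟨∑ σ, n σ, exists_globalExtension_eq fun σ => ?_⟩
  rw [map_nsmul, ← sub_eq_zero, ← smul_sub, hc, ← TensorProduct.tmul_smul, ← ofMul_pow,
    ← Finset.add_sum_erase _ _ (Finset.mem_univ σ), pow_add, pow_mul, hn, one_pow, ofMul_one,
    TensorProduct.tmul_zero]

/-- If `σ x - x` is a root of unity for all `σ`, then the divisor of `x` comes from `K`, since this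
is true of a multiple of `x`. -/
theorem exists_divisorExtension_eq_divisorMap [IsGalois K L] (hlog : IsLocallyCyclotomic ℓ K L)
    {x : GlobalR ℓ L} {c : (L ≃ₐ[K] L) → globalMu ℓ L}
    (hc : ∀ σ, galoisAction ℓ σ x - x = 1 ⊗ₜ Additive.ofMul (c σ : Lˣ)) :
    ∃ d, divisorExtension ℓ K L d = divisorMap ℓ L x := by
  obtain ⟨n, y, hy⟩ := exists_globalExtension_eq_pow_smul hc
  refine exists_divisorExtension_eq hlog (n := n) (d := divisorMap ℓ K y) ?_
  rw [← LinearMap.comp_apply, divisorExtension_divisorMap, LinearMap.comp_apply, hy, map_nsmul]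

/-- Every cocycle with values in `μ_L` is `σ ↦ σ x - x` for some pseudo-infinitesimal `x`. By
Hilbert 90 it is `σ ↦ σ y / y` for some `y ∈ L^×` with a power in `K`. As `L/K` is locally
cyclotomic, `y` is, up to a root of unity, a local element of `K` at each place above `ℓ`;
dividing `y` by a global element of `ℛ_K` with these localizations gives `x`. -/
theorem exists_pseudoInfinitesimal_of_cocycle [IsGalois K L] (hℓ2 : ℓ ≠ 2)
    (hlog : IsLocallyCyclotomic ℓ K L) {c : (L ≃ₐ[K] L) → globalMu ℓ L}
    (hc : groupCohomology.IsMulCocycle₁ c) :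
    ∃ x ∈ pseudoInfinitesimal ℓ L, ∀ σ,
      galoisAction ℓ σ x - x = 1 ⊗ₜ Additive.ofMul (c σ : Lˣ) := by
  classical
  have := FiniteDimensional.right ℚ K L
  obtain ⟨y, hy⟩ := groupCohomology.isMulCoboundary₁_of_isMulCocycle₁_of_aut_to_units
    (fun σ => (c σ : Lˣ)) (fun σ τ => congrArg Subtype.val (hc σ τ))
  choose n hn using fun σ => CommMonoid.mem_primaryComponent.mp (c σ).2
  obtain ⟨N, a, ha⟩ : ∃ (N : ℕ) (a : K), algebraMap K L a = (y : L) ^ ℓ ^ N := by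
    refine ⟨∑ σ, n σ, (IsGalois.mem_range_algebraMap_iff_fixed (F := K) _).mpr fun σ => ?_⟩
    have h1 : (σ • y) ^ ℓ ^ (∑ σ, n σ) = y ^ ℓ ^ (∑ σ, n σ) := by
      rw [← div_eq_one, ← div_pow, hy, ← Finset.add_sum_erase _ _ (Finset.mem_univ σ), pow_add,
        pow_mul, hn, one_pow]
    rw [map_pow]
    exact congrArg Units.val h1
  -- in `L_w`, `y = ξ k` with `ξ ^ (ℓ ^ (m - N)) = 1`; the resulting relation between `k` and `a`
  -- holds in `K_v` and so does not depend on `w`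
  have hlocal : ∀ v : WildPlace ℓ K, ∃ (k : (v.1.adicCompletion K)ˣ) (m : ℕ),
      (k : v.1.adicCompletion K) ^ ℓ ^ m = algebraMap K _ (a ^ ℓ ^ (m - N)) ∧ N ≤ m := by
    rintro ⟨v, hv⟩
    obtain ⟨w, rfl⟩ := exists_placeBelow_eq (L := L) v
    have hyw : algebraMap L (w.adicCompletion L) (y : L) ≠ 0 := by simp
    obtain ⟨ξ, k, ⟨m, hm⟩, hk⟩ := exists_root_mul_completionMap hℓ2 hlog (placeBelow K w) w hyw
      (n := N) (a := algebraMap K _ a) (by rw [completionMap_apply_algebraMap, ha, map_pow])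
    have hk0 : k ≠ 0 := by
      rintro rfl
      rw [map_zero, mul_zero] at hk
      exact hyw hk
    refine ⟨Units.mk0 k hk0, N + m, ?_, Nat.le_add_right N m⟩
    apply (completionMap (placeBelow K w) w).injective
    rw [Units.val_mk0, completionMap_apply_algebraMap, map_pow, map_pow, ha, ← pow_mul, ← pow_add,
      Nat.add_sub_cancel_left, map_pow, hk, mul_pow, add_comm N m, pow_add ℓ m, pow_mul ξ, hm,
      one_pow, one_mul]
  choose k m hk hm using hlocal
  obtain ⟨z, hz⟩ := exists_localize_eq k
  refine ⟨1 ⊗ₜ Additive.ofMul y - globalExtension ℓ K L z, ?_, fun σ => ?_⟩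
  · simp only [pseudoInfinitesimal, Submodule.mem_iInf, Submodule.mem_comap]
    intro w
    let v : WildPlace ℓ K := ⟨placeBelow K w.1, natCast_mem_placeBelow.mpr w.2⟩
    have : w.1.asIdeal.LiesOver v.1.asIdeal := liesOver_placeBelow w.1
    refine mem_localMu_iff.mpr ⟨Units.map (algebraMap L (w.1.adicCompletion L)).toMonoidHom y /
      Units.map (completionMap v.1 w.1).toMonoidHom (k v), ⟨m v, ?_⟩, ?_⟩
    · rw [div_pow, div_eq_one]
      apply Units.ext
      change algebraMap L (w.1.adicCompletion L) (y : L) ^ ℓ ^ m v =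
        completionMap v.1 w.1 (k v : v.1.adicCompletion K) ^ ℓ ^ m v
      rw [← map_pow (completionMap v.1 w.1), hk, completionMap_apply_algebraMap, map_pow, ha,
        ← pow_mul, ← pow_add, Nat.add_sub_cancel' (hm v), map_pow]
    · rw [map_sub, localize_globalExtension_apply v.1 w.1, hz, localExtension_toLocalR, ofMul_div,
        map_sub, localize, LinearMap.liftBaseChange_tmul, one_smul]
      rfl
  · rw [map_sub, galoisAction_globalExtension, sub_sub_sub_cancel_right, galoisAction_one_tmul,
      ← TensorProduct.tmul_sub, ← ofMul_div, hy]

end Descent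

/-! ### Capitulation and cohomology -/

section Capitulation

open groupCohomology

variable {ℓ : ℕ} [Fact ℓ.Prime]

/-- `μ_L` embeds in `ℛ_L`. -/
theorem globalMu_eq_of_one_tmul_eq {L : Type*} [Field L] {ζ ξ : globalMu ℓ L}
    (h : (1 : ℤ_[ℓ]) ⊗ₜ[ℤ] Additive.ofMul (ζ : Lˣ) = 1 ⊗ₜ Additive.ofMul (ξ : Lˣ)) : ζ = ξ := by
  obtain ⟨n, hn⟩ := CommMonoid.mem_primaryComponent.mp (ζ / ξ).2
  have h1 := eq_zero_of_one_tmul_eq_zero (ℓ := ℓ) (n := n)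
    (a := Additive.ofMul ((ζ / ξ : globalMu ℓ L) : Lˣ)) (by rw [← ofMul_pow, hn, ofMul_one])
    (by rw [Subgroup.coe_div, ofMul_div, TensorProduct.tmul_sub, h, sub_self])
  exact div_eq_one.mp (Subtype.ext (congrArg Additive.toMul h1))

theorem one_tmul_mem_pseudoInfinitesimal {L : Type*} [Field L] [NumberField L] (ζ : globalMu ℓ L) :
    1 ⊗ₜ Additive.ofMul (ζ : Lˣ) ∈ pseudoInfinitesimal ℓ L := by
  obtain ⟨n, hn⟩ := CommMonoid.mem_primaryComponent.mp ζ.2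
  simp only [pseudoInfinitesimal, Submodule.mem_iInf, Submodule.mem_comap]
  intro w
  refine mem_localMu_iff.mpr ⟨Units.map (algebraMap L (w.1.adicCompletion L)).toMonoidHom ζ,
    ⟨n, by rw [← map_pow, hn, map_one]⟩, ?_⟩
  rw [localize, LinearMap.liftBaseChange_tmul, one_smul]
  rfl

theorem divisorMap_one_tmul {L : Type*} [Field L] [NumberField L] (ζ : globalMu ℓ L) :
    divisorMap ℓ L (1 ⊗ₜ Additive.ofMul (ζ : Lˣ)) = 0 := by
  have hℓ : ℓ.Prime := Fact.out
  obtain ⟨n, hn⟩ := CommMonoid.mem_primaryComponent.mp ζ.2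
  have h : ((ℓ ^ n : ℕ) : ℤ_[ℓ]) • divisorMap ℓ L (1 ⊗ₜ Additive.ofMul (ζ : Lˣ)) = 0 := by
    rw [Nat.cast_smul_eq_nsmul, ← map_nsmul, ← TensorProduct.tmul_smul, ← ofMul_pow, hn, ofMul_one,
      TensorProduct.tmul_zero, map_zero]
  exact (smul_eq_zero.mp h).resolve_left (by exact_mod_cast (pow_pos hℓ.pos n).ne')

variable {K L : Type} [Field K] [NumberField K] [Field L] [NumberField L] [Algebra K L]

variable (ℓ K L) in
/-- The pairs `(x, d)` of a pseudo-infinitesimal element `x` of `ℛ_L` and of a divisor `d` of `K`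
whose extension to `L` is the divisor of `x`. -/
def descentPairs : Submodule ℤ_[ℓ] (pseudoInfinitesimal ℓ L × Divisor ℓ K) :=
  LinearMap.eqLocus ((divisorExtension ℓ K L).comp (LinearMap.snd _ _ _))
    ((divisorMap ℓ L).comp ((pseudoInfinitesimal ℓ L).subtype.comp (LinearMap.fst _ _ _)))

theorem divisorExtension_snd (p : descentPairs ℓ K L) :
    divisorExtension ℓ K L p.1.2 = divisorMap ℓ L (p.1.1 : GlobalR ℓ L) := p.2

/-- Leopoldt's conjecture makes `σ x - x` a root of unity: it is pseudo-infinitesimal, and has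
trivial divisor because the divisor of `x` comes from `K`. -/
theorem exists_galoisAction_sub_eq (hleo : LeopoldtConjecture ℓ L) (p : descentPairs ℓ K L)
    (σ : L ≃ₐ[K] L) : ∃ ζ : globalMu ℓ L,
      galoisAction ℓ σ (p.1.1 : GlobalR ℓ L) - (p.1.1 : GlobalR ℓ L) = 1 ⊗ₜ Additive.ofMul (ζ : Lˣ) :=
  exists_root_of_divisorMap_eq_zero hleo (sub_mem (galoisAction_mem σ p.1.1.2) p.1.1.2)
    (by rw [map_sub, divisorMap_galoisAction σ (divisorExtension_snd p), sub_self])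

/-- The cocycle `σ ↦ σ x - x` with values in `μ_L` attached to a pair `(x, d)`. -/
def descentCocycle (hleo : LeopoldtConjecture ℓ L) (p : descentPairs ℓ K L) (σ : L ≃ₐ[K] L) :
    globalMu ℓ L :=
  (exists_galoisAction_sub_eq hleo p σ).choose

theorem descentCocycle_spec (hleo : LeopoldtConjecture ℓ L) (p : descentPairs ℓ K L)
    (σ : L ≃ₐ[K] L) : galoisAction ℓ σ (p.1.1 : GlobalR ℓ L) - (p.1.1 : GlobalR ℓ L) =
      1 ⊗ₜ Additive.ofMul (descentCocycle hleo p σ : Lˣ) :=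
  (exists_galoisAction_sub_eq hleo p σ).choose_spec

theorem descentCocycle_eq (hleo : LeopoldtConjecture ℓ L) {p : descentPairs ℓ K L}
    {σ : L ≃ₐ[K] L} {ζ : globalMu ℓ L} (h : galoisAction ℓ σ (p.1.1 : GlobalR ℓ L) - (p.1.1 : GlobalR ℓ L) =
      1 ⊗ₜ Additive.ofMul (ζ : Lˣ)) : descentCocycle hleo p σ = ζ :=
  globalMu_eq_of_one_tmul_eq ((descentCocycle_spec hleo p σ).symm.trans h)

theorem isMulCocycle₁_descentCocycle (hleo : LeopoldtConjecture ℓ L) (p : descentPairs ℓ K L) :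
    IsMulCocycle₁ (descentCocycle hleo p) := by
  intro σ τ
  refine descentCocycle_eq hleo ?_
  have h : ((σ • descentCocycle hleo p τ : globalMu ℓ L) : Lˣ) =
      σ • (descentCocycle hleo p τ : Lˣ) := rfl
  rw [Subgroup.coe_mul, ofMul_mul, TensorProduct.tmul_add, ← descentCocycle_spec, h,
    ← galoisAction_one_tmul, ← descentCocycle_spec, galoisAction_mul, map_sub, sub_add_sub_cancel]

theorem descentCocycle_add (hleo : LeopoldtConjecture ℓ L) (p q : descentPairs ℓ K L)
    (σ : L ≃ₐ[K] L) :
    descentCocycle hleo (p + q) σ = descentCocycle hleo p σ * descentCocycle hleo q σ := by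
  refine descentCocycle_eq hleo ?_
  rw [Subgroup.coe_mul, ofMul_mul, TensorProduct.tmul_add, ← descentCocycle_spec,
    ← descentCocycle_spec, sub_add_sub_comm, ← map_add]
  rfl

/-- The homomorphism `(x, d) ↦ (σ ↦ σ x - x)` to the cocycles. -/
def toCocycles (hleo : LeopoldtConjecture ℓ L) : descentPairs ℓ K L →+
    cocycles₁ (Rep.ofMulDistribMulAction (L ≃ₐ[K] L) (globalMu ℓ L)) :=
  AddMonoidHom.mk' (fun p => cocyclesOfIsMulCocycle₁ (isMulCocycle₁_descentCocycle hleo p))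
    fun p q => Subtype.ext (funext fun σ => congrArg Additive.ofMul (descentCocycle_add hleo p q σ))

/-- The homomorphism `(x, d) ↦ [σ ↦ σ x - x]` to the first cohomology group. -/
def toH1 (hleo : LeopoldtConjecture ℓ L) : descentPairs ℓ K L →+ H1Mu ℓ K L :=
  (H1π (Rep.ofMulDistribMulAction (L ≃ₐ[K] L) (globalMu ℓ L))).hom.toAddMonoidHom.comp
    (toCocycles hleo)

theorem toH1_eq_zero_iff (hleo : LeopoldtConjecture ℓ L) (p : descentPairs ℓ K L) :
    toH1 hleo p = 0 ↔ IsMulCoboundary₁ (descentCocycle hleo p) :=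
  (H1π_eq_zero_iff _).trans ⟨fun h => isMulCoboundary₁_of_mem_coboundaries₁ _ h,
    fun h => (coboundariesOfIsMulCoboundary₁ h).2⟩

theorem toH1_surjective [IsGalois K L] (hℓ2 : ℓ ≠ 2) (hlog : IsLocallyCyclotomic ℓ K L)
    (hleo : LeopoldtConjecture ℓ L) : Function.Surjective (toH1 (K := K) hleo) := by
  intro h
  induction h using H1_induction_on with
  | h c =>
    have hc := isMulCocycle₁_of_mem_cocycles₁ (G := L ≃ₐ[K] L) (M := globalMu ℓ L) c.1 c.2
    obtain ⟨x, hx, hσ⟩ := exists_pseudoInfinitesimal_of_cocycle hℓ2 hlog hc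
    obtain ⟨d, hd⟩ := exists_divisorExtension_eq_divisorMap hlog hσ
    refine ⟨⟨⟨⟨x, hx⟩, d⟩, hd⟩, congrArg (H1π _).hom (Subtype.ext (funext fun σ => ?_))⟩
    exact congrArg Additive.ofMul (descentCocycle_eq hleo (hσ σ))

/-- The homomorphism `(x, d) ↦ [d]` to the capitulation kernel. -/
def toCapitulation : descentPairs ℓ K L →+ LinearMap.ker (classExtension ℓ K L) :=
  AddMonoidHom.mk' (fun p => ⟨Submodule.Quotient.mk p.1.2, by
    refine (Submodule.Quotient.mk_eq_zero _).mpr ?_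
    rw [divisorExtension_snd]
    exact Submodule.mem_map_of_mem p.1.1.2⟩) fun _ _ => rfl

theorem toCapitulation_surjective :
    Function.Surjective (toCapitulation (ℓ := ℓ) (K := K) (L := L)) := by
  rintro ⟨t, ht⟩
  obtain ⟨d, rfl⟩ := Submodule.Quotient.mk_surjective _ t
  obtain ⟨x, hx, hxd⟩ := (Submodule.Quotient.mk_eq_zero _).mp (LinearMap.mem_ker.mp ht)
  exact ⟨⟨⟨⟨x, hx⟩, d⟩, hxd.symm⟩, rfl⟩

theorem toCapitulation_eq_zero_iff (p : descentPairs ℓ K L) :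
    toCapitulation p = 0 ↔ ∃ y ∈ pseudoInfinitesimal ℓ K, divisorMap ℓ K y = p.1.2 :=
  Subtype.ext_iff.trans (Submodule.Quotient.mk_eq_zero _)

/-- Both homomorphisms kill exactly the pairs `(x, d)` for which `x` is the product of a
pseudo-infinitesimal element of `ℛ_K` and a root of unity. -/
theorem toH1_eq_zero_iff_toCapitulation_eq_zero [IsGalois K L] (hℓ2 : ℓ ≠ 2)
    (hlog : IsLocallyCyclotomic ℓ K L) (hleo : LeopoldtConjecture ℓ L) (p : descentPairs ℓ K L) :
    toH1 hleo p = 0 ↔ toCapitulation p = 0 := by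
  have := FiniteDimensional.right ℚ K L
  have hext : ∀ y : GlobalR ℓ K, divisorExtension ℓ K L (divisorMap ℓ K y) =
      divisorMap ℓ L (globalExtension ℓ K L y) :=
    fun y => LinearMap.congr_fun (divisorExtension_divisorMap ℓ K L) y
  rw [toH1_eq_zero_iff, toCapitulation_eq_zero_iff]
  constructor
  · rintro ⟨ζ, hζ⟩
    obtain ⟨y, hy⟩ := exists_globalExtension_eq (K := K)
      (x := (p.1.1 : GlobalR ℓ L) - 1 ⊗ₜ Additive.ofMul (ζ : Lˣ)) fun σ => by
        have h := descentCocycle_spec hleo p σ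
        rw [← hζ, Subgroup.coe_div, ofMul_div, TensorProduct.tmul_sub] at h
        rw [map_sub, galoisAction_one_tmul, sub_eq_sub_iff_sub_eq_sub]
        exact h
    refine ⟨y, mem_pseudoInfinitesimal_of_globalExtension_mem hℓ2 hlog ?_,
      divisorExtension_injective hlog ?_⟩
    · rw [hy]
      exact sub_mem p.1.1.2 (one_tmul_mem_pseudoInfinitesimal ζ)
    · rw [hext, hy, map_sub, divisorMap_one_tmul, sub_zero, divisorExtension_snd]
  · rintro ⟨y, hy, hyd⟩
    obtain ⟨ζ, hζ⟩ := exists_root_of_divisorMap_eq_zero hleo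
      (x := (p.1.1 : GlobalR ℓ L) - globalExtension ℓ K L y)
      (sub_mem p.1.1.2 (globalExtension_mem ℓ K L hy))
      (by rw [map_sub, ← hext, hyd, divisorExtension_snd, sub_self])
    refine ⟨ζ, fun σ => (descentCocycle_eq hleo (p := p) (σ := σ) (ζ := σ • ζ / ζ) ?_).symm⟩
    have h : ((σ • ζ : globalMu ℓ L) : Lˣ) = σ • (ζ : Lˣ) := rfl
    rw [Subgroup.coe_div, ofMul_div, TensorProduct.tmul_sub, h, ← galoisAction_one_tmul, ← hζ,
      map_sub, galoisAction_globalExtension, sub_sub_sub_cancel_right]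

theorem nonempty_addEquiv_of_surjective {N A B : Type*} [AddCommGroup N] [AddCommGroup A]
    [AddCommGroup B] {g : N →+ A} {f : N →+ B} (hg : Function.Surjective g)
    (hf : Function.Surjective f) (h : ∀ p, f p = 0 ↔ g p = 0) : Nonempty (A ≃+ B) :=
  ⟨(QuotientAddGroup.quotientKerEquivOfSurjective g hg).symm.trans
    ((QuotientAddGroup.quotientAddEquivOfEq (AddSubgroup.ext fun p => (h p).symm)).trans
      (QuotientAddGroup.quotientKerEquivOfSurjective f hf))⟩

/-- The capitulation kernel is isomorphic to `H¹(Gal(L/K), μ_L)`. -/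
theorem nonempty_capitulation_addEquiv [IsGalois K L] (hℓ2 : ℓ ≠ 2)
    (hlog : IsLocallyCyclotomic ℓ K L) (hleo : LeopoldtConjecture ℓ L) :
    Nonempty (LinearMap.ker (classExtension ℓ K L) ≃+ H1Mu ℓ K L) :=
  nonempty_addEquiv_of_surjective toCapitulation_surjective (toH1_surjective hℓ2 hlog hleo)
    (toH1_eq_zero_iff_toCapitulation_eq_zero hℓ2 hlog hleo)

/-- The capitulation kernel is a torsion group: if `d` becomes the divisor of `x`, some multiple
`ℓⁿ x` comes from `ℛ_K`, and `ℓⁿ d` is its divisor. -/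
theorem mem_torsionBP_of_mem_ker [IsGalois K L] (hℓ2 : ℓ ≠ 2) (hlog : IsLocallyCyclotomic ℓ K L)
    (hleo : LeopoldtConjecture ℓ L) {t : ClassBP ℓ K}
    (ht : t ∈ LinearMap.ker (classExtension ℓ K L)) : t ∈ torsionBP ℓ K := by
  have hℓ : ℓ.Prime := Fact.out
  obtain ⟨p, hp⟩ := toCapitulation_surjective ⟨t, ht⟩
  obtain ⟨n, y, hy⟩ := exists_globalExtension_eq_pow_smul (descentCocycle_spec hleo p)
  refine (Submodule.mem_torsion_iff t).mpr ⟨⟨((ℓ ^ n : ℕ) : ℤ_[ℓ]), mem_nonZeroDivisors_of_ne_zero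
    (by exact_mod_cast (pow_pos hℓ.pos n).ne')⟩, ?_⟩
  rw [show t = Submodule.Quotient.mk p.1.2 from (congrArg Subtype.val hp).symm, Submonoid.mk_smul,
    Nat.cast_smul_eq_nsmul, ← Submodule.Quotient.mk_smul, Submodule.Quotient.mk_eq_zero]
  refine ⟨y, mem_pseudoInfinitesimal_of_globalExtension_mem hℓ2 hlog ?_,
    divisorExtension_injective hlog ?_⟩
  · rw [hy]
    exact nsmul_mem p.1.1.2 _
  · rw [← LinearMap.comp_apply, divisorExtension_divisorMap, LinearMap.comp_apply, hy, map_nsmul,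
      map_nsmul, divisorExtension_snd]

/-- The kernels on the torsion submodules and on the whole class groups coincide. -/
theorem nonempty_ker_torsionExtension_addEquiv [IsGalois K L] (hℓ2 : ℓ ≠ 2)
    (hlog : IsLocallyCyclotomic ℓ K L) (hleo : LeopoldtConjecture ℓ L) :
    Nonempty (LinearMap.ker (torsionExtension ℓ K L) ≃+ LinearMap.ker (classExtension ℓ K L)) := by
  let f : LinearMap.ker (torsionExtension ℓ K L) →+ LinearMap.ker (classExtension ℓ K L) :=
    AddMonoidHom.mk' (fun t => ⟨t.1.1, congrArg Subtype.val (LinearMap.mem_ker.mp t.2)⟩)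
      fun _ _ => rfl
  refine ⟨AddEquiv.ofBijective f ⟨fun s t h => ?_, fun t => ?_⟩⟩
  · exact Subtype.ext (Subtype.ext (congrArg
      (fun t : LinearMap.ker (classExtension ℓ K L) => (t : ClassBP ℓ K)) h))
  · exact ⟨⟨⟨t.1, mem_torsionBP_of_mem_ker hℓ2 hlog hleo t.2⟩, Subtype.ext t.2⟩, rfl⟩

end Capitulation

end BertrandiasPayan

end

theorem mainTheorem7 (ℓ : ℕ) [Fact ℓ.Prime] (hℓ : ℓ ≠ 2)
    (K L : Type) [Field K] [NumberField K] [Field L] [NumberField L] [Algebra K L] [IsGalois K L]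
    (hdeg : ∃ n : ℕ, Module.finrank K L = ℓ ^ n)
    (hlog : BertrandiasPayan.IsLocallyCyclotomic ℓ K L)
    (hleo : BertrandiasPayan.LeopoldtConjecture ℓ L) :
    Nonempty (LinearMap.ker (BertrandiasPayan.classExtension ℓ K L) ≃+
        BertrandiasPayan.H1Mu ℓ K L) ∧
      Nonempty (LinearMap.ker (BertrandiasPayan.torsionExtension ℓ K L) ≃+
        BertrandiasPayan.H1Mu ℓ K L) := by
  obtain ⟨e⟩ := BertrandiasPayan.nonempty_capitulation_addEquiv hℓ hlog hleo
  obtain ⟨e'⟩ := BertrandiasPayan.nonempty_ker_torsionExtension_addEquiv hℓ hlog hleo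
  exact ⟨⟨e⟩, ⟨e'.trans e⟩⟩
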